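/- Let $X$ be a nonempty compact Hausdorff space. Let $\mathcal L_{\mathsf S}$ be the one-sorted language with a predicate symbol for every closed $C\subseteq X^n$ ($n\ge 1$) and a function symbol for every continuous $f\colon X^n\to X$ ($n\ge 0$); $X$ is regarded as an $\mathcal L_{\mathsf S}$-structure in the obvious way. Let $\mathcal L_{\mathsf H}$ be an arbitrary first-order language, and let $\mathcal L$ be a two-sorted language, with sorts $\mathsf H$ and $\mathsf S$, that expands $\mathcal L_{\mathsf H}$ (on $\mathsf H$) and $\mathcal L_{\mathsf S}$ (on $\mathsf S$) and whose only new symbols are function symbols of sort $\mathsf H^n\to\mathsf S$ with $n\ge 1$. The cardinality $|\mathcal L|$ is the number of symbols (equivalently, since there are infinitely many symbols, of formulas) of $\mathcal L$. A standard structure is an $\mathcal L$-structure $\langle M,X\rangle$ where $M$ is an $\mathcal L_{\mathsf H}$-structure and $X$ is the fixed $\mathcal L_{\mathsf S}$-structure; it is denoted by $M$, and its cardinality is $|M|$. Let $\mathcal F$ be the least set of $\mathcal L$-formulas that contains all $\mathcal L_{\mathsf H}$-formulas and all formulas $t\in C$, where $C\subseteq X^n$ is closed, $n\ge 1$, and $t$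 is an $n$-tuple of terms of sort $\mathsf S$, and that is closed under $\wedge$, $\vee$ and the quantifiers $\forall,\exists$ of both sorts. For $A\subseteq M$, $\mathcal F(A)$ denotes the set of such formulas with parameters from $A$. A standard structure $N$ is an $\mathcal F$-elementary extension of $M$ if $M\subseteq N$ and for every $\varphi(x)\in\mathcal F$ (with $x$ a finite tuple of variables of sort $\mathsf H$) and every $a\in M^{|x|}$, $M\models\varphi(a)$ implies $N\models\varphi(a)$. A standard structure $N$ is $\mathcal F$-saturated if for every $A\subseteq N$ with $|A|<|N|$, every set of formulas $p(x;\eta)\subseteq\mathcal F(A)$ (where $x$ and $\eta$ are finite tuples of variables of sort $\mathsf H$ and $\mathsf S$ respectively) each of whose finite subsets is realized in $N$ by some tuple of $N^{|x|}\times X^{|\eta|}$ is itself realized in $N$ by some tuple of $N^{|x|}\times X^{|\eta|}$. Theorem. Let $\lambda$ be a cardinal such that $\lambda^{<\lambda}=\lambda>|\mathcal L|$. Then every standard structure $M$ of cardinality $\lambda$ has an $\mathcal F$-elementary extension to an $\mathcal F$-saturated standard structure of cardinality $\lambda$. -/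

import Mathlib

open FirstOrder Cardinal

universe u v t x w w' a b

/-- The variable part of a two-sorted language with a home sort `H` and a space sort `S`: an
arbitrary first-order language `home` for the sort `H`, and function symbols of sort `Hⁿ → S`,
`n ≥ 1`; the elements of `toSpace n` are the symbols of sort `Hⁿ⁺¹ → S`.
The symbols of the space sort are determined by the space `X`: see `HomeSpaceLanguage.Symbols`. -/
structure HomeSpaceLanguage where
  home : FirstOrder.Language.{u, v}
  toSpace : ℕ → Type t

namespace HomeSpaceLanguage

/-- All non-logical symbols of the two-sorted language over the space `X`: the symbols of the home
language, a predicate symbol for every closed subset of `Xⁿ` (`n ≥ 1`), a function symbol for every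
continuous map `Xⁿ → X` (`n ≥ 0`), and the function symbols of sort `Hⁿ → S` (`n ≥ 1`). -/
def Symbols (L : HomeSpaceLanguage.{u, v, t}) (X : Type x) [TopologicalSpace X] :
    Type (max u v t x) :=
  (L.home.Symbols ⊕ (Σ n : ℕ, TopologicalSpace.Closeds (Fin (n + 1) → X))) ⊕
    ((Σ n : ℕ, C(Fin n → X, X)) ⊕ (Σ n : ℕ, L.toSpace n))

/-- The cardinality of the two-sorted language over `X`. For nonempty `X` there are infinitely many
symbols (`aleph0_le_card`), so this is also the number of formulas in countably many variables. -/
def card (L : HomeSpaceLanguage.{u, v, t}) (X : Type x) [TopologicalSpace X] :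
    Cardinal.{max u v t x} :=
  #(L.Symbols X)

theorem aleph0_le_card (L : HomeSpaceLanguage.{u, v, t}) (X : Type x) [TopologicalSpace X]
    [Nonempty X] : ℵ₀ ≤ L.card X := by
  have : Infinite (L.Symbols X) := by
    refine Infinite.of_injective
      (fun n : ℕ => (Sum.inr (Sum.inl ⟨n, ContinuousMap.const _ (Classical.arbitrary X)⟩) :
        L.Symbols X)) ?_
    intro a b h
    exact congrArg Sigma.fst (Sum.inl.inj (Sum.inr.inj h))
  exact Cardinal.aleph0_le_mk _

/-- Terms of sort `S` with home variables indexed by `α` and space variables indexed by `β`. -/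
inductive SpaceTerm (L : HomeSpaceLanguage.{u, v, t}) (X : Type x) [TopologicalSpace X]
    (α : Type a) (β : Type b) : Type (max u v t x a b)
  | var (j : β) : SpaceTerm L X α β
  | spaceFun {n : ℕ} (f : C(Fin n → X, X)) (ts : Fin n → SpaceTerm L X α β) : SpaceTerm L X α β
  | mixedFun {n : ℕ} (g : L.toSpace n) (ts : Fin (n + 1) → L.home.Term α) : SpaceTerm L X α β

/-- The class of `F`-formulas: free home variables are indexed by `α ⊕ Fin k` and free space
variables by `β ⊕ Fin l`, where the variables in `Fin k` and `Fin l` are those to be quantified.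
It contains all formulas of the home language and the formulas `t ∈ C` with `C ⊆ Xⁿ` closed,
`n ≥ 1`, and is generated by them under `∧`, `∨` and the quantifiers of both sorts. -/
inductive FBoundedFormula (L : HomeSpaceLanguage.{u, v, t}) (X : Type x) [TopologicalSpace X]
    (α : Type a) (β : Type b) : ℕ → ℕ → Type (max u v t x a b)
  | home {k l : ℕ} (φ : L.home.BoundedFormula α k) : FBoundedFormula L X α β k l
  | mem {k l n : ℕ} (ts : Fin (n + 1) → SpaceTerm L X (α ⊕ Fin k) (β ⊕ Fin l))
      (C : TopologicalSpace.Closeds (Fin (n + 1) → X)) : FBoundedFormula L X α β k l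
  | and {k l : ℕ} (φ ψ : FBoundedFormula L X α β k l) : FBoundedFormula L X α β k l
  | or {k l : ℕ} (φ ψ : FBoundedFormula L X α β k l) : FBoundedFormula L X α β k l
  | allH {k l : ℕ} (φ : FBoundedFormula L X α β (k + 1) l) : FBoundedFormula L X α β k l
  | exH {k l : ℕ} (φ : FBoundedFormula L X α β (k + 1) l) : FBoundedFormula L X α β k l
  | allS {k l : ℕ} (φ : FBoundedFormula L X α β k (l + 1)) : FBoundedFormula L X α β k l
  | exS {k l : ℕ} (φ : FBoundedFormula L X α β k (l + 1)) : FBoundedFormula L X α β k l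

/-- `F`-formulas with free home variables in `α` and free space variables in `β`. -/
abbrev FFormula (L : HomeSpaceLanguage.{u, v, t}) (X : Type x) [TopologicalSpace X]
    (α : Type a) (β : Type b) :=
  L.FBoundedFormula X α β 0 0

end HomeSpaceLanguage

/-- A standard structure `⟨M, X⟩`: a home structure together with interpretations of the function
symbols of sort `Hⁿ → S`. The symbols of the space sort are interpreted in `X` as themselves. -/
structure StandardStructure (L : HomeSpaceLanguage.{u, v, t}) (X : Type x) where
  carrier : Type w
  homeStructure : L.home.Structure carrier
  mixedMap : ∀ {n : ℕ}, L.toSpace n → (Fin (n + 1) → carrier) → X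

namespace StandardStructure

instance (L : HomeSpaceLanguage.{u, v, t}) (X : Type x) :
    CoeSort (StandardStructure.{u, v, t, x, w} L X) (Type w) :=
  ⟨StandardStructure.carrier⟩

instance (L : HomeSpaceLanguage.{u, v, t}) (X : Type x) (M : StandardStructure.{u, v, t, x, w} L X) :
    L.home.Structure M :=
  M.homeStructure

variable {L : HomeSpaceLanguage.{u, v, t}} {X : Type x} [TopologicalSpace X]

/-- The value of a term of sort `S`. -/
def termValue (M : StandardStructure.{u, v, t, x, w} L X) {α : Type a} {β : Type b}
    (c : α → M) (d : β → X) : L.SpaceTerm X α β → X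
  | .var j => d j
  | .spaceFun f ts => f fun i => termValue M c d (ts i)
  | .mixedFun g ts => M.mixedMap g fun i => (ts i).realize c

/-- Satisfaction of `F`-formulas in a standard structure. -/
def RealizeBounded (M : StandardStructure.{u, v, t, x, w} L X) {α : Type a} {β : Type b} :
    ∀ {k l : ℕ}, L.FBoundedFormula X α β k l →
      (α → M) → (β → X) → (Fin k → M) → (Fin l → X) → Prop
  | _, _, .home φ, c, _, y, _ => φ.Realize c y
  | _, _, .mem ts C, c, d, y, z =>
      (fun i => M.termValue (Sum.elim c y) (Sum.elim d z) (ts i)) ∈ C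
  | _, _, .and φ ψ, c, d, y, z => M.RealizeBounded φ c d y z ∧ M.RealizeBounded ψ c d y z
  | _, _, .or φ ψ, c, d, y, z => M.RealizeBounded φ c d y z ∨ M.RealizeBounded ψ c d y z
  | _, _, .allH φ, c, d, y, z => ∀ m : M, M.RealizeBounded φ c d (Fin.snoc y m) z
  | _, _, .exH φ, c, d, y, z => ∃ m : M, M.RealizeBounded φ c d (Fin.snoc y m) z
  | _, _, .allS φ, c, d, y, z => ∀ s : X, M.RealizeBounded φ c d y (Fin.snoc z s)
  | _, _, .exS φ, c, d, y, z => ∃ s : X, M.RealizeBounded φ c d y (Fin.snoc z s)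

/-- `M ⊨ φ(c ; d)`. -/
def Realize (M : StandardStructure.{u, v, t, x, w} L X) {α : Type a} {β : Type b}
    (φ : L.FFormula X α β) (c : α → M) (d : β → X) : Prop :=
  M.RealizeBounded φ c d Fin.elim0 Fin.elim0

/-- A total map `e : M → N` is an `F`-elementary embedding if `M ⊨ φ(a)` implies `N ⊨ φ(e a)` for
every `F`-formula `φ(x)`, where `x` is a finite tuple of home variables. The reverse implication is
not required, as `F` is not closed under negation. -/
def IsFElementaryEmbedding (M : StandardStructure.{u, v, t, x, w} L X)
    (N : StandardStructure.{u, v, t, x, w'} L X) (e : M → N) : Prop :=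
  ∀ (n : ℕ) (φ : L.FFormula X (Fin n) Empty) (c : Fin n → M),
    M.Realize φ c Empty.elim → N.Realize φ (e ∘ c) Empty.elim

/-- The tuple `(c ; d)` realizes in `N` the set `p(x ; η)` of `F`-formulas with parameters in `A`.
The parameters are the variables `Sum.inl a`, `a ∈ A`, which are interpreted as `a`. -/
def RealizesType (N : StandardStructure.{u, v, t, x, w} L X) {A : Set N} {n m : ℕ}
    (p : Set (L.FFormula X (A ⊕ Fin n) (Fin m))) (c : Fin n → N) (d : Fin m → X) : Prop :=
  ∀ φ ∈ p, N.Realize φ (Sum.elim (fun a : A => (a : N)) c) d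

/-- `N` is `κ`-`F`-saturated: every type `p(x ; η)` of `F`-formulas with parameters in a set of
fewer than `κ` elements of `N` that is finitely realized in `N` is realized in `N`. -/
def IsFSaturatedAt (N : StandardStructure.{u, v, t, x, w} L X) (κ : Cardinal.{w}) : Prop :=
  ∀ A : Set N, #A < κ → ∀ (n m : ℕ) (p : Set (L.FFormula X (A ⊕ Fin n) (Fin m))),
    (∀ q ⊆ p, q.Finite → ∃ (c : Fin n → N) (d : Fin m → X), N.RealizesType q c d) →
      ∃ (c : Fin n → N) (d : Fin m → X), N.RealizesType p c d

/-- `N` is `F`-saturated if it is `|N|`-`F`-saturated. -/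
def IsFSaturated (N : StandardStructure.{u, v, t, x, w} L X) : Prop :=
  N.IsFSaturatedAt #N

end StandardStructure

-- Formulas in `F` are positive in their closed-set part, so they survive ultraproducts in which
-- values in $X$ are replaced by ultralimits: a closed set contains limits of its points,
-- compactness of $X$ supplies the limits, and home formulas obey Łoś's theorem. Truth passes only
-- from the factors to the ultraproduct (`realizeBounded_ultraproduct`), which still yields
-- compactness for `F` with parameters in $X$ (`satisfiable_of_finite`).
--
-- Without negation one cannot complete a theory. Instead, κ blocks of new constants are added to
-- $M$, and the types over fewer than κ constants are enumerated so that each occurs cofinally. The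
-- $j$-th type is committed to, with the $j$-th block as its realization, exactly when this is
-- satisfiable together with the diagram of $M$ and the earlier commitments; compactness makes the
-- whole theory $T$ satisfiable. Any type realized in some model of $T$ is then realized by
-- constants in every model of $T$ (`exists_hasWitnesses`): the model that realizes it shows, after
-- reinterpreting block $j$, that the request was accepted. The hypothesis κ^{<κ} = κ bounds the
-- number of types by κ and makes κ regular, so parameters precede some stage.
--
-- In a model of $T$ the constants form an elementary home substructure, and `F`-formulas descend to
-- it, since witnesses for home quantifiers are constants and the space sort is unchanged
-- (`HasWitnesses.realize_restrict`). The resulting $N$ is a model of $T$ consisting of constants. A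
-- type finitely realized in $N$ is consistent with $T$ by compactness, hence realized in some model
-- of $T$, hence by constants in $N$ (`HasWitnesses.isFSaturatedAt`).

universe a' b'

namespace HomeSpaceLanguage

/-! ### Renaming variables in formulas. -/

section Relabel

variable {L : HomeSpaceLanguage.{u, v, t}} {X : Type x} [TopologicalSpace X]
  {α : Type a} {β : Type b} {α' : Type a'} {β' : Type b'}

/-- Extend a map of variables by sending the last bound variable to the last bound variable. -/
def liftVar {α : Type a} {α' : Type a'} {k k' : ℕ} (g : α ⊕ Fin k → α' ⊕ Fin k') :
    α ⊕ Fin (k + 1) → α' ⊕ Fin (k' + 1)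
  | .inl i => Sum.map id Fin.castSucc (g (.inl i))
  | .inr i => Fin.lastCases (motive := fun _ => α' ⊕ Fin (k' + 1)) (.inr (Fin.last k'))
      (fun i => Sum.map id Fin.castSucc (g (.inr i))) i

theorem elim_snoc_comp_liftVar {M : Type w} {k k' : ℕ} {g : α ⊕ Fin k → α' ⊕ Fin k'}
    {c : α → M} {y : Fin k → M} {c' : α' → M} {y' : Fin k' → M}
    (h : Sum.elim c' y' ∘ g = Sum.elim c y) (m : M) :
    Sum.elim c' (Fin.snoc y' m : Fin (k' + 1) → M) ∘ liftVar g =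
      Sum.elim c (Fin.snoc y m : Fin (k + 1) → M) := by
  have key : ∀ s : α' ⊕ Fin k', Sum.elim c' (Fin.snoc y' m : Fin (k' + 1) → M)
      (Sum.map id Fin.castSucc s) = Sum.elim c' y' s := by
    rintro (s | s) <;> simp
  funext s
  rcases s with s | s
  · exact (key _).trans (congrFun h (.inl s))
  · refine Fin.lastCases ?_ (fun s => ?_) s
    · simp [liftVar]
    · simpa [liftVar, key] using congrFun h (.inr s)

/-- Rename the free and bound variables of a formula of the home language. -/
def relabelHome {L : FirstOrder.Language.{u, v}} : ∀ {k k' : ℕ}, L.BoundedFormula α k →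
    (α ⊕ Fin k → α' ⊕ Fin k') → L.BoundedFormula α' k'
  | _, _, .falsum, _ => .falsum
  | _, _, .equal t s, g => .equal (t.relabel g) (s.relabel g)
  | _, _, .rel R ts, g => .rel R fun i => (ts i).relabel g
  | _, _, .imp φ ψ, g => .imp (relabelHome φ g) (relabelHome ψ g)
  | _, _, .all φ, g => .all (relabelHome φ (liftVar g))

/-- The renaming may exchange the roles of free and bound indices, so only the combined valuations
are compared; `elim_snoc_comp_liftVar` carries this hypothesis under a quantifier. -/
theorem realize_relabelHome {L : FirstOrder.Language.{u, v}} {M : Type w} [L.Structure M]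
    {k k' : ℕ} (φ : L.BoundedFormula α k) (g : α ⊕ Fin k → α' ⊕ Fin k')
    {c : α → M} {y : Fin k → M} {c' : α' → M} {y' : Fin k' → M}
    (h : Sum.elim c' y' ∘ g = Sum.elim c y) :
    (relabelHome φ g).Realize c' y' ↔ φ.Realize c y := by
  induction φ generalizing k' with
  | falsum => rfl
  | equal t s => simp [relabelHome, Language.BoundedFormula.Realize, h]
  | rel R ts => simp [relabelHome, Language.BoundedFormula.Realize, h]
  | imp φ ψ ihφ ihψ =>
    simp [relabelHome, Language.BoundedFormula.Realize, ihφ g h, ihψ g h]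
  | all φ ih =>
    simp only [relabelHome, Language.BoundedFormula.Realize]
    exact forall_congr' fun m => ih _ (elim_snoc_comp_liftVar h m)

/-- Rename the variables of a term of sort `S`. -/
def SpaceTerm.relabel (g : α → α') (h : β → β') : L.SpaceTerm X α β → L.SpaceTerm X α' β'
  | .var j => .var (h j)
  | .spaceFun f ts => .spaceFun f fun i => (ts i).relabel g h
  | .mixedFun f ts => .mixedFun f fun i => (ts i).relabel g

/-- Rename the free and bound variables of an `F`-formula. -/
def FBoundedFormula.relabel : ∀ {k l k' l' : ℕ}, L.FBoundedFormula X α β k l →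
    (α ⊕ Fin k → α' ⊕ Fin k') → (β ⊕ Fin l → β' ⊕ Fin l') → L.FBoundedFormula X α' β' k' l'
  | _, _, _, _, .home φ, g, _ => .home (relabelHome φ g)
  | _, _, _, _, .mem ts C, g, h => .mem (fun i => (ts i).relabel g h) C
  | _, _, _, _, .and φ ψ, g, h => .and (φ.relabel g h) (ψ.relabel g h)
  | _, _, _, _, .or φ ψ, g, h => .or (φ.relabel g h) (ψ.relabel g h)
  | _, _, _, _, .allH φ, g, h => .allH (φ.relabel (liftVar g) h)
  | _, _, _, _, .exH φ, g, h => .exH (φ.relabel (liftVar g) h)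
  | _, _, _, _, .allS φ, g, h => .allS (φ.relabel g (liftVar h))
  | _, _, _, _, .exS φ, g, h => .exS (φ.relabel g (liftVar h))

/-- Rename the variables of an `F`-formula without bound variables. -/
def FFormula.relabel (φ : L.FFormula X α β) (g : α → α') (h : β → β') : L.FFormula X α' β' :=
  FBoundedFormula.relabel φ (Sum.map g id) (Sum.map h id)

/-- Turn the variables to be quantified of an `F`-formula into free variables. -/
def FBoundedFormula.free {k l : ℕ} (φ : L.FBoundedFormula X α β k l)
    (g : α ⊕ Fin k → α') (h : β ⊕ Fin l → β') : L.FFormula X α' β' :=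
  φ.relabel (fun i => .inl (g i)) (fun j => .inl (h j))

end Relabel

end HomeSpaceLanguage

namespace StandardStructure

section Realize

open HomeSpaceLanguage

variable {L : HomeSpaceLanguage.{u, v, t}} {X : Type x} [TopologicalSpace X]
  {α : Type a} {β : Type b} {α' : Type a'} {β' : Type b'}

theorem termValue_relabel (M : StandardStructure.{u, v, t, x, w} L X) (s : L.SpaceTerm X α β)
    (g : α → α') (h : β → β') (c : α' → M) (d : β' → X) :
    M.termValue c d (s.relabel g h) = M.termValue (c ∘ g) (d ∘ h) s := by
  induction s with
  | var j => rfl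
  | spaceFun f ts ih => simp [SpaceTerm.relabel, termValue, ih]
  | mixedFun f ts => simp [SpaceTerm.relabel, termValue]

theorem realizeBounded_relabel (M : StandardStructure.{u, v, t, x, w} L X) {k l k' l' : ℕ}
    (φ : L.FBoundedFormula X α β k l)
    (g : α ⊕ Fin k → α' ⊕ Fin k') (h : β ⊕ Fin l → β' ⊕ Fin l')
    {c : α → M} {y : Fin k → M} {c' : α' → M} {y' : Fin k' → M}
    {d : β → X} {z : Fin l → X} {d' : β' → X} {z' : Fin l' → X}
    (hg : Sum.elim c' y' ∘ g = Sum.elim c y) (hh : Sum.elim d' z' ∘ h = Sum.elim d z) :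
    M.RealizeBounded (φ.relabel g h) c' d' y' z' ↔ M.RealizeBounded φ c d y z := by
  induction φ generalizing k' l' with
  | home φ => exact realize_relabelHome φ g hg
  | mem ts C => simp [FBoundedFormula.relabel, RealizeBounded, termValue_relabel, hg, hh]
  | and φ ψ ihφ ihψ => exact and_congr (ihφ g h hg hh) (ihψ g h hg hh)
  | or φ ψ ihφ ihψ => exact or_congr (ihφ g h hg hh) (ihψ g h hg hh)
  | allH φ ih => exact forall_congr' fun m => ih _ _ (elim_snoc_comp_liftVar hg m) hh
  | exH φ ih => exact exists_congr fun m => ih _ _ (elim_snoc_comp_liftVar hg m) hh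
  | allS φ ih => exact forall_congr' fun m => ih _ _ hg (elim_snoc_comp_liftVar hh m)
  | exS φ ih => exact exists_congr fun m => ih _ _ hg (elim_snoc_comp_liftVar hh m)

theorem realize_relabel (M : StandardStructure.{u, v, t, x, w} L X)
    (φ : L.FFormula X α β) (g : α → α') (h : β → β') (c : α' → M) (d : β' → X) :
    M.Realize (φ.relabel g h) c d ↔ M.Realize φ (c ∘ g) (d ∘ h) := by
  refine M.realizeBounded_relabel φ _ _ ?_ ?_ <;>
  · funext i
    rcases i with i | i
    · rfl
    · exact i.elim0

theorem realize_free (M : StandardStructure.{u, v, t, x, w} L X) {k l : ℕ}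
    (φ : L.FBoundedFormula X α β k l) (g : α ⊕ Fin k → α') (h : β ⊕ Fin l → β')
    (c : α' → M) (d : β' → X) :
    M.Realize (φ.free g h) c d ↔
      M.RealizeBounded φ (c ∘ g ∘ Sum.inl) (d ∘ h ∘ Sum.inl) (c ∘ g ∘ Sum.inr)
        (d ∘ h ∘ Sum.inr) := by
  refine M.realizeBounded_relabel φ _ _ ?_ ?_ <;>
  · funext i
    rcases i with i | i <;> rfl

end Realize

end StandardStructure

namespace StandardStructure

/-! ### Ultraproducts of standard structures. -/

section Ultraproduct

open HomeSpaceLanguage Filter Topology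

variable {L : HomeSpaceLanguage.{u, v, t}} {X : Type x} [TopologicalSpace X] {α : Type a} {β : Type b} {I : Type w'}

theorem snoc_apply_family {k : ℕ} {M : I → Type w} (y : Fin k → ∀ i, M i) (m : ∀ i, M i) (i : I) :
    (fun j => (Fin.snoc y m : Fin (k + 1) → ∀ i, M i) j i) =
      (Fin.snoc (fun j => y j i) (m i) : Fin (k + 1) → M i) := by
  funext j
  refine Fin.lastCases ?_ (fun j => ?_) j <;> simp

theorem tendsto_snoc {U : Ultrafilter I} {l : ℕ} {z : I → Fin l → X} {z' : Fin l → X}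
    (hz : ∀ j, Tendsto (fun i => z i j) U (𝓝 (z' j))) {s : I → X} {s' : X}
    (hs : Tendsto s U (𝓝 s')) (j : Fin (l + 1)) :
    Tendsto (fun i => (Fin.snoc (z i) (s i) : Fin (l + 1) → X) j) U
      (𝓝 ((Fin.snoc z' s' : Fin (l + 1) → X) j)) := by
  refine Fin.lastCases ?_ (fun j => ?_) j
  · simpa using hs
  · simpa using hz j

/-- The limit of a family of points of a compact space along an ultrafilter. -/
noncomputable def ultralim (U : Ultrafilter I) (s : I → X) : X :=
  (U.map s).lim

theorem tendsto_ultralim [CompactSpace X] (U : Ultrafilter I) (s : I → X) :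
    Tendsto s U (𝓝 (ultralim U s)) :=
  (U.map s).le_nhds_lim

/-- The standard ultraproduct: the ultraproduct of the home structures, with the mixed functions
evaluated as limits in `X`. -/
noncomputable def ultraproduct (U : Ultrafilter I) (M : I → StandardStructure.{u, v, t, x, w} L X) :
    StandardStructure.{u, v, t, x, max w' w} L X where
  carrier := (U : Filter I).Product fun i => M i
  homeStructure := Language.Ultraproduct.structure
  mixedMap g m := ultralim U fun i => (M i).mixedMap g fun j => Quotient.out (m j) i

variable {U : Ultrafilter I} {M : I → StandardStructure.{u, v, t, x, w} L X}

/-- The class of a family in the standard ultraproduct. -/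
def ultraproductMk (U : Ultrafilter I) (M : I → StandardStructure.{u, v, t, x, w} L X)
    (m : ∀ i, M i) : ultraproduct U M :=
  Quotient.mk ((U : Filter I).productSetoid fun i => M i) m

theorem ultraproductMk_surjective (m : ultraproduct U M) : ∃ m', ultraproductMk U M m' = m :=
  ⟨Quotient.out m, Quotient.out_eq m⟩

variable [CompactSpace X]

/-- The definition uses chosen representatives; other representatives agree with them almost
everywhere, so the limit is the same. -/
theorem tendsto_mixedMap_ultraproduct {n : ℕ} (g : L.toSpace n) (m : Fin (n + 1) → ∀ i, M i) :
    Tendsto (fun i => (M i).mixedMap g fun j => m j i) U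
      (𝓝 ((ultraproduct U M).mixedMap g fun j => ultraproductMk U M (m j))) := by
  refine (tendsto_ultralim U _).congr' ?_
  have h : ∀ j, ∀ᶠ i in (U : Filter I),
      (Quotient.out (ultraproductMk U M (m j)) : ∀ i, M i) i = m j i := fun j =>
    Quotient.mk_out (s := (U : Filter I).productSetoid fun i => M i) (m j)
  filter_upwards [eventually_all.2 h] with i hi
  exact congrArg _ (funext hi)

theorem tendsto_termValue_ultraproduct (s : L.SpaceTerm X α β) (c : α → ∀ i, M i)
    {d : I → β → X} {d' : β → X} (hd : ∀ j, Tendsto (fun i => d i j) U (𝓝 (d' j))) :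
    Tendsto (fun i => (M i).termValue (fun j => c j i) (d i) s) U
      (𝓝 ((ultraproduct U M).termValue (fun j => ultraproductMk U M (c j)) d' s)) := by
  induction s with
  | var j => exact hd j
  | spaceFun f ts ih =>
    exact (f.continuous.tendsto _).comp (tendsto_pi_nhds.2 ih)
  | mixedFun g ts =>
    have : ∀ j, (ts j).realize (fun k => ultraproductMk U M (c k)) =
        ultraproductMk U M fun i => (ts j).realize fun k => c k i := fun j =>
      Language.Ultraproduct.term_realize_cast (M := fun i => (M i : Type w)) c (ts j)
    simp only [termValue, this]
    exact tendsto_mixedMap_ultraproduct g _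

/-- The half of Łoś's theorem that holds for `F`. Space values may vary with the index and are
replaced by limits. Atomic formulas pass because $C$ is closed, disjunctions because the filter is
an ultrafilter, `allS` by constant families, and `exS` by taking the ultralimit of chosen witnesses.
-/
theorem realizeBounded_ultraproduct [Nonempty X] [∀ i, Nonempty (M i)] {k l : ℕ}
    (φ : L.FBoundedFormula X α β k l) (c : α → ∀ i, M i) (y : Fin k → ∀ i, M i)
    {d : I → β → X} {d' : β → X} (hd : ∀ j, Tendsto (fun i => d i j) U (𝓝 (d' j)))
    {z : I → Fin l → X} {z' : Fin l → X} (hz : ∀ j, Tendsto (fun i => z i j) U (𝓝 (z' j)))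
    (h : ∀ᶠ i in (U : Filter I),
      (M i).RealizeBounded φ (fun j => c j i) (d i) (fun j => y j i) (z i)) :
    (ultraproduct U M).RealizeBounded φ (fun j => ultraproductMk U M (c j)) d'
      (fun j => ultraproductMk U M (y j)) z' := by
  induction φ with
  | home φ =>
    exact (Language.Ultraproduct.boundedFormula_realize_cast (M := fun i => (M i : Type w))
      φ c y).2 h
  | mem ts C =>
    refine C.isClosed.mem_of_tendsto (tendsto_pi_nhds.2 fun j => ?_) h
    have hc : ∀ i, (Sum.elim (fun j => c j i) fun j => y j i) =
        fun j => (Sum.elim c y : _ → ∀ i, M i) j i := fun i => by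
      funext j; rcases j with j | j <;> rfl
    have hc' : (Sum.elim (fun j => ultraproductMk U M (c j)) fun j => ultraproductMk U M (y j)) =
        fun j => ultraproductMk U M ((Sum.elim c y : _ → ∀ i, M i) j) := by
      funext j; rcases j with j | j <;> rfl
    simp only [hc, hc']
    refine tendsto_termValue_ultraproduct (ts j) (Sum.elim c y) ?_
    rintro (j | j)
    · exact hd j
    · exact hz j
  | and φ ψ ihφ ihψ =>
    exact ⟨ihφ y hz (h.mono fun _ h => h.1), ihψ y hz (h.mono fun _ h => h.2)⟩
  | or φ ψ ihφ ihψ =>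
    exact (Ultrafilter.eventually_or.1 h).imp (ihφ y hz) (ihψ y hz)
  | allH φ ih =>
    intro m
    obtain ⟨m, rfl⟩ := ultraproductMk_surjective m
    have := ih (Fin.snoc y m) hz (h.mono fun i hi => by
      rw [snoc_apply_family]; exact hi (m i))
    rwa [show (fun j => ultraproductMk U M ((Fin.snoc y m : Fin _ → ∀ i, M i) j)) = _ from
      Fin.comp_snoc (ultraproductMk U M) y m] at this
  | exH φ ih =>
    have : ∀ i, ∃ m : M i, (M i).RealizeBounded (.exH φ) (fun j => c j i) (d i)
        (fun j => y j i) (z i) → (M i).RealizeBounded φ (fun j => c j i) (d i)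
        (Fin.snoc (fun j => y j i) m) (z i) := fun i => by
      by_cases hi : ∃ m : M i, (M i).RealizeBounded φ (fun j => c j i) (d i)
        (Fin.snoc (fun j => y j i) m) (z i)
      · exact hi.imp fun _ hm _ => hm
      · exact ⟨Classical.arbitrary _, fun h => (hi h).elim⟩
    choose m hm using this
    refine ⟨ultraproductMk U M m, ?_⟩
    have := ih (Fin.snoc y m) hz (h.mono fun i hi => by
      rw [snoc_apply_family]; exact hm i hi)
    rwa [show (fun j => ultraproductMk U M ((Fin.snoc y m : Fin _ → ∀ i, M i) j)) = _ from
      Fin.comp_snoc (ultraproductMk U M) y m] at this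
  | allS φ ih =>
    intro s
    exact ih y (tendsto_snoc hz tendsto_const_nhds) (h.mono fun i hi => hi s)
  | exS φ ih =>
    have : ∀ i, ∃ s : X, (M i).RealizeBounded (.exS φ) (fun j => c j i) (d i)
        (fun j => y j i) (z i) → (M i).RealizeBounded φ (fun j => c j i) (d i)
        (fun j => y j i) (Fin.snoc (z i) s) := fun i => by
      by_cases hi : ∃ s : X, (M i).RealizeBounded φ (fun j => c j i) (d i)
        (fun j => y j i) (Fin.snoc (z i) s)
      · exact hi.imp fun _ hs _ => hs
      · exact ⟨Classical.arbitrary _, fun h => (hi h).elim⟩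
    choose s hs using this
    exact ⟨ultralim U s, ih y (tendsto_snoc hz (tendsto_ultralim U s)) (h.mono fun i hi => hs i hi)⟩

end Ultraproduct

/-! ### Compactness for `F`-formulas. -/

section Compactness

open HomeSpaceLanguage Filter Topology

variable {L : HomeSpaceLanguage.{u, v, t}} {X : Type x} [TopologicalSpace X]
  {α : Type a} {β : Type b}

/-- `M ⊨ T(c ; d)` for a set `T` of `F`-formulas with parameters in the space `X`, which are the
space variables `Sum.inl s`. -/
def Models (M : StandardStructure.{u, v, t, x, w} L X) (T : Set (L.FFormula X α (X ⊕ β)))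
    (c : α → M) (d : β → X) : Prop :=
  ∀ φ ∈ T, M.Realize φ c (Sum.elim id d)

/-- A set of `F`-formulas with parameters in `X` is satisfiable if it is realized in a standard
structure. -/
def Satisfiable (T : Set (L.FFormula X α (X ⊕ β))) : Prop :=
  ∃ (M : StandardStructure.{u, v, t, x, w} L X) (c : α → M) (d : β → X), M.Models T c d

theorem Models.mono {M : StandardStructure.{u, v, t, x, w} L X}
    {T T' : Set (L.FFormula X α (X ⊕ β))} {c : α → M} {d : β → X} (h : M.Models T c d)
    (hT : T' ⊆ T) : M.Models T' c d :=
  fun φ hφ => h φ (hT hφ)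

variable [CompactSpace X] [Nonempty X]

/-- The compactness theorem for `F`-formulas. -/
theorem satisfiable_of_finite {α : Type (max u v t x w)} {β : Type (max u v t x w)} [Nonempty α]
    {T : Set (L.FFormula X α (X ⊕ β))}
    (h : ∀ q ⊆ T, q.Finite → Satisfiable.{u, v, t, x, max u v t x w} q) :
    Satisfiable.{u, v, t, x, max u v t x w} T := by
  classical
  have h' : ∀ i : Finset T, Satisfiable.{u, v, t, x, max u v t x w}
      ((↑) '' (i : Set T) : Set (L.FFormula X α (X ⊕ β))) := fun i =>
    h _ (by rintro _ ⟨φ, -, rfl⟩; exact φ.2) (i.finite_toSet.image _)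
  choose M c d hM using h'
  have : ∀ i, Nonempty (M i) := fun i => ⟨c i (Classical.arbitrary α)⟩
  -- Each formula of `T` lies in all sufficiently large finite subsets, hence holds in almost every
  -- factor.
  let U : Ultrafilter (Finset T) := Ultrafilter.of atTop
  refine ⟨ultraproduct U M, fun j => ultraproductMk U M fun i => c i j,
    fun j => ultralim U fun i => d i j, fun φ hφ => ?_⟩
  have key := realizeBounded_ultraproduct (U := U) (M := M) φ (fun j i => c i j)
    (fun j => j.elim0) (d := fun i => Sum.elim id (d i))
    (d' := Sum.elim id fun j => ultralim U fun i => d i j) (z := fun _ => Fin.elim0)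
    (z' := Fin.elim0) (by
      rintro (s | j)
      · exact tendsto_const_nhds
      · exact tendsto_ultralim U fun i => d i j) (fun j => j.elim0) (by
      refine Ultrafilter.of_le atTop ((eventually_ge_atTop {⟨φ, hφ⟩}).mono fun i hi => ?_)
      have := hM i φ ⟨⟨φ, hφ⟩, Finset.singleton_subset_iff.1 hi, rfl⟩
      rwa [Subsingleton.elim (fun j : Fin 0 => (j.elim0 : ∀ i, M i) i) Fin.elim0])
  rwa [Realize, Subsingleton.elim Fin.elim0 fun j => ultraproductMk U M j.elim0]

end Compactness

end StandardStructure

/-! ### Closure properties of the types that embed in a fixed infinite type. -/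

section Embedding

variable {S : Type w} [Infinite S] {T : Type a} {T' : Type b}

/-- Embeddings into `S` serve as cardinal bounds that compare types in different universes without
lifts. -/
theorem nonempty_embedding_prod (h : Nonempty (T ↪ S)) (h' : Nonempty (T' ↪ S)) :
    Nonempty (T × T' ↪ S) := by
  have : Nonempty (S × S ↪ S) := by
    rw [← Cardinal.le_def, Cardinal.mk_prod, Cardinal.lift_id,
      Cardinal.mul_eq_self (Cardinal.aleph0_le_mk S)]
  exact ⟨(h.some.prodMap h'.some).trans this.some⟩

theorem nonempty_nat_embedding : Nonempty (ℕ ↪ S) :=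
  ⟨Infinite.natEmbedding S⟩

theorem nonempty_embedding_of_finite [Finite T] : Nonempty (T ↪ S) := by
  obtain ⟨n, ⟨e⟩⟩ := Finite.exists_equiv_fin T
  exact ⟨(e.toEmbedding.trans Fin.valEmbedding).trans (Infinite.natEmbedding S)⟩

theorem nonempty_embedding_sigma {ι : Type a} {T : ι → Type b} (h : Nonempty (ι ↪ S))
    (h' : ∀ i, Nonempty (T i ↪ S)) : Nonempty ((Σ i, T i) ↪ S) := by
  refine (nonempty_embedding_prod h ⟨Function.Embedding.refl S⟩).map fun e =>
    Function.Embedding.trans ⟨fun p => (p.1, (h' p.1).some p.2), ?_⟩ e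
  rintro ⟨i, p⟩ ⟨j, q⟩ hpq
  obtain ⟨rfl, hpq⟩ := Prod.mk.inj hpq
  exact congrArg _ ((h' i).some.injective hpq)

theorem nonempty_embedding_sum (h : Nonempty (T ↪ S)) (h' : Nonempty (T' ↪ S)) :
    Nonempty (T ⊕ T' ↪ S) := by
  refine (nonempty_embedding_prod (nonempty_embedding_of_finite (T := Bool))
    ⟨Function.Embedding.refl S⟩).map fun e => Function.Embedding.trans
      ⟨Sum.elim (fun p => (true, h.some p)) (fun p => (false, h'.some p)), ?_⟩ e
  rintro (p | p) (q | q) hpq <;> simp_all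

theorem nonempty_embedding_list (h : Nonempty (T ↪ S)) : Nonempty (List T ↪ S) := by
  have : Nonempty (List S ↪ S) := by
    rw [← Cardinal.le_def, Cardinal.mk_list_eq_mk]
  exact ⟨Function.Embedding.trans ⟨List.map h.some, List.map_injective_iff.2 h.some.injective⟩
    this.some⟩

theorem nonempty_embedding_fin_fun (h : Nonempty (T ↪ S)) (n : ℕ) :
    Nonempty ((Fin n → T) ↪ S) :=
  (nonempty_embedding_list h).map fun e => Function.Embedding.trans
    ⟨List.ofFn, List.ofFn_injective⟩ e

theorem nonempty_embedding_wType {A : Type a} {B : A → Type b} [∀ i, Finite (B i)]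
    (h : Nonempty (A ↪ S)) : Nonempty (WType B ↪ S) := by
  rw [← Cardinal.lift_mk_le'] at h ⊢
  have h₁ := Cardinal.lift_le.{w}.2 (WType.cardinalMk_le_max_aleph0_of_finite' (β := B))
  refine h₁.trans ?_
  rw [Cardinal.lift_max, max_le_iff]
  constructor
  · rw [Cardinal.lift_lift]
    have := Cardinal.lift_le.{b}.2 h
    simpa using this
  · simp

end Embedding

/-! ### Counting formulas through their syntax trees. -/

namespace HomeSpaceLanguage

variable {L : HomeSpaceLanguage.{u, v, t}} {X : Type x} [TopologicalSpace X]
  {α : Type a} {β : Type b}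

/-- The labels of the syntax tree of a term of sort `S`. -/
abbrev SpaceTerm.Label (L : HomeSpaceLanguage.{u, v, t}) (X : Type x) [TopologicalSpace X]
    (α : Type a) (β : Type b) :=
  β ⊕ ((Σ n, C(Fin n → X, X)) ⊕ (Σ n, L.toSpace n × (Fin (n + 1) → L.home.Term α)))

/-- The number of children of a node of the syntax tree of a term of sort `S`. -/
def SpaceTerm.arity : SpaceTerm.Label L X α β → ℕ
  | .inl _ => 0
  | .inr (.inl f) => f.1
  | .inr (.inr _) => 0

/-- The syntax tree of a term of sort `S`. -/
def SpaceTerm.toWType : L.SpaceTerm X α β →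
    WType fun i : SpaceTerm.Label L X α β => Fin (SpaceTerm.arity i)
  | .var j => ⟨.inl j, Fin.elim0⟩
  | @SpaceTerm.spaceFun _ _ _ _ _ n f ts => ⟨.inr (.inl ⟨n, f⟩), fun i => (ts i).toWType⟩
  | @SpaceTerm.mixedFun _ _ _ _ _ n g ts => ⟨.inr (.inr ⟨n, g, ts⟩), Fin.elim0⟩

theorem SpaceTerm.toWType_injective :
    Function.Injective (SpaceTerm.toWType : L.SpaceTerm X α β → _) := by
  intro s
  induction s with
  | var j =>
    intro s' h
    cases s' with
    | var j' => rw [Sum.inl.inj (WType.mk.inj h).1]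
    | _ => exact absurd (WType.mk.inj h).1 (by simp)
  | @spaceFun n f ts ih =>
    intro s' h
    cases s' with
    | var j => exact absurd (WType.mk.inj h).1 (by simp)
    | @spaceFun n' f' ts' =>
      obtain ⟨h, h'⟩ := WType.mk.inj h
      cases h
      congr 1
      exact funext fun i => ih i (congrFun (eq_of_heq h') i)
    | mixedFun => exact absurd (WType.mk.inj h).1 (by simp)
  | @mixedFun n g ts =>
    intro s' h
    cases s' with
    | var j => exact absurd (WType.mk.inj h).1 (by simp)
    | spaceFun => exact absurd (WType.mk.inj h).1 (by simp)
    | @mixedFun n' g' ts' =>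
      cases (WType.mk.inj h).1
      rfl

/-- The labels of the syntax tree of an `F`-formula. -/
abbrev FBoundedFormula.Label (L : HomeSpaceLanguage.{u, v, t}) (X : Type x) [TopologicalSpace X]
    (α : Type a) (β : Type b) :=
  (Σ k, L.home.BoundedFormula α k) ⊕ ((Σ k l n, (Fin (n + 1) → L.SpaceTerm X (α ⊕ Fin k)
    (β ⊕ Fin l)) × TopologicalSpace.Closeds (Fin (n + 1) → X)) ⊕ (Fin 2 ⊕ Fin 4))

/-- The number of children of a node of the syntax tree of an `F`-formula. -/
def FBoundedFormula.arity : FBoundedFormula.Label L X α β → ℕ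
  | .inl _ => 0
  | .inr (.inl _) => 0
  | .inr (.inr (.inl _)) => 2
  | .inr (.inr (.inr _)) => 1

/-- The syntax tree of an `F`-formula. -/
def FBoundedFormula.toWType : ∀ {k l : ℕ}, L.FBoundedFormula X α β k l →
    WType fun i : FBoundedFormula.Label L X α β => Fin (FBoundedFormula.arity i)
  | k, _, .home φ => ⟨.inl ⟨k, φ⟩, Fin.elim0⟩
  | k, l, @FBoundedFormula.mem _ _ _ _ _ _ _ n ts C => ⟨.inr (.inl ⟨k, l, n, ts, C⟩), Fin.elim0⟩
  | _, _, .and φ ψ => ⟨.inr (.inr (.inl 0)), ![φ.toWType, ψ.toWType]⟩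
  | _, _, .or φ ψ => ⟨.inr (.inr (.inl 1)), ![φ.toWType, ψ.toWType]⟩
  | _, _, .allH φ => ⟨.inr (.inr (.inr 0)), ![φ.toWType]⟩
  | _, _, .exH φ => ⟨.inr (.inr (.inr 1)), ![φ.toWType]⟩
  | _, _, .allS φ => ⟨.inr (.inr (.inr 2)), ![φ.toWType]⟩
  | _, _, .exS φ => ⟨.inr (.inr (.inr 3)), ![φ.toWType]⟩

/-- With `k` and `l` fixed, the label of a node determines the indices of its subformulas, so
connectives and quantifiers need not record them. -/
theorem FBoundedFormula.toWType_injective {k l : ℕ} :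
    Function.Injective (FBoundedFormula.toWType : L.FBoundedFormula X α β k l → _) := by
  intro φ
  induction φ with
  | home φ =>
    intro ψ h
    cases ψ with
    | home ψ => cases (WType.mk.inj h).1; rfl
    | _ => exact absurd (WType.mk.inj h).1 (by simp)
  | mem ts C =>
    intro ψ h
    cases ψ with
    | mem ts' C' =>
      cases (WType.mk.inj h).1
      rfl
    | _ => exact absurd (WType.mk.inj h).1 (by simp)
  | and φ₁ φ₂ ih₁ ih₂ =>
    intro ψ h
    cases ψ with
    | and ψ₁ ψ₂ =>
      have h' := eq_of_heq (WType.mk.inj h).2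
      rw [ih₁ (congrFun h' (0 : Fin 2)), ih₂ (congrFun h' (1 : Fin 2))]
    | _ => exact absurd (WType.mk.inj h).1 (by simp)
  | or φ₁ φ₂ ih₁ ih₂ =>
    intro ψ h
    cases ψ with
    | or ψ₁ ψ₂ =>
      have h' := eq_of_heq (WType.mk.inj h).2
      rw [ih₁ (congrFun h' (0 : Fin 2)), ih₂ (congrFun h' (1 : Fin 2))]
    | _ => exact absurd (WType.mk.inj h).1 (by simp)
  | allH φ ih =>
    intro ψ h
    cases ψ with
    | allH ψ => rw [ih (congrFun (eq_of_heq (WType.mk.inj h).2) (0 : Fin 1))]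
    | _ => exact absurd (WType.mk.inj h).1 (by simp)
  | exH φ ih =>
    intro ψ h
    cases ψ with
    | exH ψ => rw [ih (congrFun (eq_of_heq (WType.mk.inj h).2) (0 : Fin 1))]
    | _ => exact absurd (WType.mk.inj h).1 (by simp)
  | allS φ ih =>
    intro ψ h
    cases ψ with
    | allS ψ => rw [ih (congrFun (eq_of_heq (WType.mk.inj h).2) (0 : Fin 1))]
    | _ => exact absurd (WType.mk.inj h).1 (by simp)
  | exS φ ih =>
    intro ψ h
    cases ψ with
    | exS ψ => rw [ih (congrFun (eq_of_heq (WType.mk.inj h).2) (0 : Fin 1))]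
    | _ => exact absurd (WType.mk.inj h).1 (by simp)

/-- Points of $X$ are nullary continuous functions, so parameters from $X$ do not increase the
number of formulas. -/
theorem nonempty_embedding_space {S : Type w} (hL : Nonempty (L.Symbols X ↪ S)) : Nonempty (X ↪ S) :=
  hL.map fun e => Function.Embedding.trans
    ⟨fun s => .inr (.inl ⟨0, ContinuousMap.const _ s⟩), fun s s' h => by
      have h := eq_of_heq (Sigma.mk.inj (Sum.inl.inj (Sum.inr.inj h))).2
      exact DFunLike.congr_fun h Fin.elim0⟩ e

section Count

variable {S : Type w} [Infinite S]

theorem nonempty_embedding_term {L : FirstOrder.Language.{u, v}}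
    (hL : Nonempty ((Σ n, L.Functions n) ↪ S)) (hα : Nonempty (α ↪ S)) :
    Nonempty (L.Term α ↪ S) :=
  (nonempty_embedding_list (nonempty_embedding_sum hα hL)).map fun e =>
    Function.Embedding.trans ⟨_, Language.Term.encoding.encode_injective⟩ e

theorem nonempty_embedding_boundedFormula {L : FirstOrder.Language.{u, v}}
    (hL : Nonempty (L.Symbols ↪ S)) (hα : Nonempty (α ↪ S)) :
    Nonempty ((Σ k, L.BoundedFormula α k) ↪ S) := by
  have hF : Nonempty ((Σ n, L.Functions n) ↪ S) := ⟨Function.Embedding.inl.trans hL.some⟩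
  have hR : Nonempty ((Σ n, L.Relations n) ↪ S) := ⟨Function.Embedding.inr.trans hL.some⟩
  refine (nonempty_embedding_list (nonempty_embedding_sum
    (nonempty_embedding_sigma nonempty_nat_embedding fun k : ℕ => nonempty_embedding_term hF
      (nonempty_embedding_sum hα nonempty_embedding_of_finite))
    (nonempty_embedding_sum hR nonempty_nat_embedding))).map fun e =>
      Function.Embedding.trans ⟨_, Language.BoundedFormula.encoding.encode_injective⟩ e

theorem nonempty_embedding_spaceTerm (hL : Nonempty (L.Symbols X ↪ S)) (hα : Nonempty (α ↪ S))
    (hβ : Nonempty (β ↪ S)) : Nonempty (L.SpaceTerm X α β ↪ S) := by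
  obtain ⟨e⟩ := hL
  have h₁ : Nonempty ((Σ n : ℕ, C(Fin n → X, X)) ↪ S) :=
    ⟨(Function.Embedding.inl.trans Function.Embedding.inr).trans e⟩
  have h₂ : Nonempty ((Σ n : ℕ, L.toSpace n) ↪ S) :=
    ⟨(Function.Embedding.inr.trans Function.Embedding.inr).trans e⟩
  have h₃ : Nonempty ((Σ n, L.home.Functions n) ↪ S) :=
    ⟨((Function.Embedding.inl.trans Function.Embedding.inl).trans Function.Embedding.inl).trans e⟩
  refine (nonempty_embedding_wType (nonempty_embedding_sum hβ (nonempty_embedding_sum h₁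
    (nonempty_embedding_sigma nonempty_nat_embedding fun n => nonempty_embedding_prod
      ⟨(Function.Embedding.sigmaMk n).trans h₂.some⟩
      (nonempty_embedding_fin_fun (nonempty_embedding_term h₃ hα) (n + 1)))))).map
    fun e => Function.Embedding.trans ⟨_, SpaceTerm.toWType_injective⟩ e

theorem nonempty_embedding_fBoundedFormula (hL : Nonempty (L.Symbols X ↪ S))
    (hα : Nonempty (α ↪ S)) (hβ : Nonempty (β ↪ S)) (k l : ℕ) :
    Nonempty (L.FBoundedFormula X α β k l ↪ S) := by
  obtain ⟨e⟩ := id hL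
  have h₁ : Nonempty ((Σ n : ℕ, TopologicalSpace.Closeds (Fin (n + 1) → X)) ↪ S) :=
    ⟨(Function.Embedding.inr.trans Function.Embedding.inl).trans e⟩
  have h₂ : Nonempty (L.home.Symbols ↪ S) :=
    ⟨(Function.Embedding.inl.trans Function.Embedding.inl).trans e⟩
  refine (nonempty_embedding_wType (nonempty_embedding_sum
    (nonempty_embedding_boundedFormula h₂ hα) (nonempty_embedding_sum
      (nonempty_embedding_sigma nonempty_nat_embedding fun k =>
        nonempty_embedding_sigma nonempty_nat_embedding fun l =>
        nonempty_embedding_sigma nonempty_nat_embedding fun n => nonempty_embedding_prod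
          (nonempty_embedding_fin_fun (nonempty_embedding_spaceTerm hL
            (nonempty_embedding_sum hα nonempty_embedding_of_finite)
            (nonempty_embedding_sum hβ nonempty_embedding_of_finite)) (n + 1))
          ⟨(Function.Embedding.sigmaMk n).trans h₁.some⟩)
      nonempty_embedding_of_finite))).map
    fun e => Function.Embedding.trans ⟨_, FBoundedFormula.toWType_injective⟩ e

end Count

end HomeSpaceLanguage

/-- The formulas embed in the disjoint union of the symbols and `α`, which is infinite and smaller
than κ. -/
theorem HomeSpaceLanguage.mk_fFormula_lt {L : HomeSpaceLanguage.{u, v, t}} {X : Type x}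
    [TopologicalSpace X] [Nonempty X] {κ : Cardinal.{max u v t x w}}
    (hL : Cardinal.lift.{max u v t x w} (L.card X) < κ)
    {α : Type (max u v t x w)} (hα : #α < κ) : #(L.FFormula X (α ⊕ ℕ) (X ⊕ ℕ)) < κ := by
  have hinf : Infinite (L.Symbols X) := Cardinal.infinite_iff.2 (L.aleph0_le_card X)
  have hκ : ℵ₀ ≤ κ := by
    have := Cardinal.lift_le.{max u v t x w}.2 (Cardinal.aleph0_le_mk (L.Symbols X))
    rw [Cardinal.lift_aleph0] at this
    exact this.trans hL.le
  have h : #(L.Symbols X ⊕ α) < κ := by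
    rw [Cardinal.mk_sum]
    refine Cardinal.add_lt_of_lt hκ ?_ ?_
    · exact hL
    · rwa [Cardinal.lift_id'.{max u v t x, max u v t x w}]
  refine lt_of_le_of_lt (Cardinal.le_def _ _ |>.2 ?_) h
  have hL : Nonempty (L.Symbols X ↪ L.Symbols X ⊕ α) := ⟨Function.Embedding.inl⟩
  exact nonempty_embedding_fBoundedFormula hL
    (nonempty_embedding_sum ⟨Function.Embedding.inr⟩ nonempty_nat_embedding)
    (nonempty_embedding_sum (nonempty_embedding_space hL) nonempty_nat_embedding) 0 0

/-! ### Enumerations of length κ and greedy selection. -/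

section Order

/-- By König's theorem κ < κ^{cof κ}, which excludes cof κ < κ. -/
theorem cof_ord_of_powerlt_eq {κ : Cardinal.{w}} (h₀ : ℵ₀ ≤ κ) (hκ : κ ^< κ = κ) :
    κ.ord.cof = κ := by
  refine le_antisymm (Ordinal.cof_ord_le κ) (not_lt.1 fun h => ?_)
  exact ((Cardinal.lt_power_cof_ord h₀).trans_le (Cardinal.le_powerlt κ h)).ne hκ.symm

theorem exists_forall_lt_of_mk_lt {κ : Cardinal.{w}} (h₀ : ℵ₀ ≤ κ) (hκ : κ ^< κ = κ)
    {α : Type w} (hα : #α < κ) (g : α → κ.ord.ToType) : ∃ j, ∀ i, g i < j := by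
  by_contra! h
  have hc : IsCofinal (Set.range g) := fun j => (h j).elim fun i hi => ⟨g i, ⟨i, rfl⟩, hi⟩
  have := (Order.cof_le hc).trans Cardinal.mk_range_le
  rw [Ordinal.cof_toType, cof_ord_of_powerlt_eq h₀ hκ] at this
  exact this.not_gt hα

theorem mk_Iio_ord_lt {κ : Cardinal.{w}} (j : κ.ord.ToType) : #(Set.Iio j) < κ := by
  simpa using Cardinal.mk_Iio_lt j (by simp)

/-- A bijection of `R` × κ with κ gives every `r` κ many indices, too many to lie in a proper
initial segment. -/
theorem exists_enumeration {κ : Cardinal.{w}} (h₀ : ℵ₀ ≤ κ) {R : Type w} (hR : #R ≤ κ)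
    [Nonempty R] : ∃ e : κ.ord.ToType → R, ∀ r j, ∃ i, j ≤ i ∧ e i = r := by
  have h : #(R × κ.ord.ToType) = #κ.ord.ToType := by
    rw [Cardinal.mk_prod, Cardinal.lift_id, Cardinal.lift_id, Cardinal.mk_toType,
      Cardinal.card_ord]
    exact Cardinal.mul_eq_right h₀ hR (Cardinal.mk_ne_zero R)
  obtain ⟨e⟩ := Cardinal.eq.1 h
  refine ⟨fun i => (e.symm i).1, fun r j => ?_⟩
  by_contra! hr
  have hlt : ∀ i, e (r, i) < j := fun i => not_le.1 fun hi => hr _ hi (by simp)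
  have hle : #κ.ord.ToType ≤ #(Set.Iio j) :=
    Cardinal.mk_le_of_injective (f := fun i => (⟨e (r, i), hlt i⟩ : Set.Iio j)) fun i i' h => by
      simpa using congrArg Subtype.val h
  rw [Cardinal.mk_toType, Cardinal.card_ord] at hle
  exact hle.not_gt (mk_Iio_ord_lt j)

theorem exists_equiv_Iio {κ : Cardinal.{w}} {α : Type w} (hα : #α < κ) :
    ∃ i : κ.ord.ToType, Nonempty (Set.Iio i ≃ α) := by
  have h : (#α).ord < Ordinal.type (α := κ.ord.ToType) (· < ·) := by
    rw [Ordinal.type_toType]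
    exact Cardinal.ord_lt_ord.2 hα
  refine ⟨Ordinal.enum (α := κ.ord.ToType) (· < ·) ⟨(#α).ord, h⟩, Cardinal.eq.1 ?_⟩
  exact (congrArg Ordinal.card (Ordinal.typein_enum (α := κ.ord.ToType) (· < ·) h)).trans
    (Cardinal.card_ord _)

/-- Greedy selection along a well-order for a property of finite character. -/
theorem exists_greedy {ι : Type w} [LinearOrder ι] [WellFoundedLT ι] (P : Set ι → Prop)
    (hmono : ∀ D D', D ⊆ D' → P D' → P D) (hfin : ∀ D, (∀ F ⊆ D, F.Finite → P F) → P D)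
    (hempty : P ∅) : ∃ D, P D ∧ ∀ i, P (insert i {k ∈ D | k < i}) → i ∈ D := by
  let H : ι → Prop := WellFoundedLT.fix fun i IH => P (insert i {k | ∃ h : k < i, IH k h})
  have hH : ∀ i, H i ↔ P (insert i {k | H k ∧ k < i}) := fun i => by
    have : H i = P (insert i {k | ∃ _ : k < i, H k}) := WellFoundedLT.fix_eq _ i
    rw [this]
    simp only [exists_prop, and_comm]
  refine ⟨{i | H i}, hfin _ fun F hF hfinite => ?_, fun i hi => (hH i).2 hi⟩
  obtain rfl | hne := F.eq_empty_or_nonempty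
  · exact hempty
  · obtain ⟨i, hi, hmax⟩ := hfinite.exists_maximalFor id F hne
    -- The largest element `i` of `F` was accepted over all of the earlier selection, which contains
    -- the rest of `F`.
    refine hmono _ _ (fun k hk => ?_) ((hH i).1 (hF hi))
    obtain h | h := lt_or_ge k i
    · exact .inr ⟨hF hk, h⟩
    · exact .inl (le_antisymm (hmax hk h) h)

end Order

namespace StandardStructure

open HomeSpaceLanguage

/-! ### The Henkin theory. -/

section Henkin

variable {L : HomeSpaceLanguage.{u, v, t}} {X : Type x} [TopologicalSpace X]
  {κ : Cardinal.{w}} {C : Type w}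

/-- Constants of the home sort: those in `C` and countably many new ones for every ordinal less
than `κ`. -/
abbrev HenkinConst (C : Type w) (κ : Cardinal.{w}) :
    Type w :=
  C ⊕ κ.ord.ToType × ℕ

/-- Formulas in the constants `HenkinConst C κ`, with parameters in `X` and countably many space
variables for every ordinal less than `κ`. -/
abbrev HenkinFormula (L : HomeSpaceLanguage.{u, v, t}) (X : Type x) [TopologicalSpace X]
    (C : Type w) (κ : Cardinal.{w}) :=
  L.FFormula X (HenkinConst C κ) (X ⊕ κ.ord.ToType × ℕ)

/-- A type in countably many variables over fewer than `κ` constants. -/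
abbrev Request (L : HomeSpaceLanguage.{u, v, t}) (X : Type x) [TopologicalSpace X]
    (C : Type w) (κ : Cardinal.{w}) : Type (max u v t x w) :=
  Σ i : κ.ord.ToType, (Set.Iio i → HenkinConst C κ) ×
    Set (L.FFormula X (Set.Iio i ⊕ ℕ) (X ⊕ ℕ))

theorem mk_henkinConst_le (h₀ : ℵ₀ ≤ κ) (hC : #C ≤ κ) :
    #(HenkinConst C κ) ≤ κ := by
  rw [Cardinal.mk_sum, Cardinal.lift_id, Cardinal.lift_id, Cardinal.mk_prod, Cardinal.mk_toType,
    Cardinal.card_ord, Cardinal.mk_nat, Cardinal.lift_aleph0, Cardinal.lift_uzero]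
  exact Cardinal.add_le_of_le h₀ hC (Cardinal.mul_le_of_le h₀ le_rfl h₀)

/-- For each of the κ indices `i` there are at most κ^{|i|} choices of parameters and 2^{<κ} sets of
formulas, each bounded by κ^{<κ} = κ. -/
theorem mk_request_le {κ : Cardinal.{max u v t x w}} {C : Type (max u v t x w)}
    [Nonempty X] (hL : Cardinal.lift.{max u v t x w} (L.card X) < κ)
    (h₀ : ℵ₀ ≤ κ) (hκ : κ ^< κ = κ) (hC : #C ≤ κ) :
    #(Request L X C κ) ≤ κ := by
  rw [Cardinal.mk_sigma]
  refine (Cardinal.sum_le_sum _ (fun _ => κ) fun i => ?_).trans ?_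
  · have hi : #(Set.Iio i) < κ := mk_Iio_ord_lt i
    have hF := mk_fFormula_lt.{u, v, t, x, w} hL hi
    rw [Cardinal.mk_prod, Cardinal.lift_id, Cardinal.lift_id]
    refine Cardinal.mul_le_of_le h₀ ?_ ?_
    · rw [← Cardinal.power_def]
      exact (Cardinal.power_le_power_right (mk_henkinConst_le h₀ hC)).trans
        ((Cardinal.le_powerlt κ hi).trans_eq hκ)
    · rw [Cardinal.mk_set]
      exact (Cardinal.power_le_power_right (Cardinal.natCast_lt_aleph0.le.trans h₀)).trans
        ((Cardinal.le_powerlt κ hF).trans_eq hκ)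
  · rw [Cardinal.sum_const, Cardinal.lift_id, Cardinal.lift_id, Cardinal.mk_toType,
      Cardinal.card_ord, Cardinal.mul_eq_self h₀]

/-- The formulas saying that a request is realized by the `j`-th new constants. -/
def Request.formulas (r : Request L X C κ) (j : κ.ord.ToType) :
    Set (HenkinFormula L X C κ) :=
  (fun φ => φ.relabel (Sum.elim r.2.1 fun n => .inr (j, n)) (Sum.map id fun n => (j, n))) '' r.2.2

/-- The parameters of a request precede the `j`-th new constants. -/
def Request.Below (r : Request L X C κ) (j : κ.ord.ToType) : Prop :=
  ∀ i s, r.2.1 i = .inr s → s.1 < j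

/-- The theory `Δ` together with the formulas saying that the requests `e j`, `j ∈ D`, are
realized. -/
def henkinTheory (Δ : Set (L.FFormula X C X)) (e : κ.ord.ToType → Request L X C κ)
    (D : Set κ.ord.ToType) : Set (HenkinFormula L X C κ) :=
  (fun φ => φ.relabel .inl .inl) '' Δ ∪ ⋃ j ∈ D, (e j).formulas j

theorem henkinTheory_mono (Δ : Set (L.FFormula X C X))
    (e : κ.ord.ToType → Request L X C κ) {D D' : Set κ.ord.ToType} (h : D ⊆ D') :
    henkinTheory Δ e D ⊆ henkinTheory Δ e D' :=
  Set.union_subset_union_right _ (Set.biUnion_subset_biUnion_left h)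

theorem exists_finite_subset_henkinTheory {Δ : Set (L.FFormula X C X)}
    {e : κ.ord.ToType → Request L X C κ} {D : Set κ.ord.ToType}
    {q : Set (HenkinFormula L X C κ)} (hq : q ⊆ henkinTheory Δ e D)
    (hfin : q.Finite) : ∃ F ⊆ D, F.Finite ∧ q ⊆ henkinTheory Δ e F := by
  have h : ∀ ψ : q, ∃ F ⊆ D, F.Finite ∧ ψ.1 ∈ henkinTheory Δ e F := by
    rintro ⟨ψ, hψ⟩
    obtain hψ | hψ := hq hψ
    · exact ⟨∅, Set.empty_subset _, Set.finite_empty, .inl hψ⟩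
    · obtain ⟨j, hj, hψ⟩ := Set.mem_iUnion₂.1 hψ
      exact ⟨{j}, Set.singleton_subset_iff.2 hj, Set.finite_singleton j,
        .inr (Set.mem_iUnion₂.2 ⟨j, rfl, hψ⟩)⟩
  choose F hFD hF hψ using h
  have := hfin.to_subtype
  exact ⟨⋃ ψ, F ψ, Set.iUnion_subset hFD, Set.finite_iUnion hF, fun ψ hψq =>
    henkinTheory_mono Δ e (Set.subset_iUnion F ⟨ψ, hψq⟩) (hψ ⟨ψ, hψq⟩)⟩

/-- Every type over fewer than `κ` constants which is realized in a model of `T` is realized by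
constants according to `T`. -/
def HasWitnesses {κ : Cardinal.{max u v t x w}} {C : Type (max u v t x w)}
    (T : Set (HenkinFormula L X C κ)) : Prop :=
  ∀ (α : Type (max u v t x w)), #α < κ → ∀ (f : α → HenkinConst C κ)
    (p : Set (L.FFormula X (α ⊕ ℕ) (X ⊕ ℕ)))
    (M : StandardStructure.{u, v, t, x, max u v t x w} L X)
    (c : HenkinConst C κ → M) (d : κ.ord.ToType × ℕ → X), M.Models T c d →
    ∀ (c' : ℕ → M) (d' : ℕ → X), M.Models p (Sum.elim (c ∘ f) c') d' →
    ∃ (c'' : ℕ → HenkinConst C κ) (d'' : ℕ → κ.ord.ToType × ℕ),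
      ∀ (N : StandardStructure.{u, v, t, x, max u v t x w} L X) (c : HenkinConst C κ → N)
        (d : κ.ord.ToType × ℕ → X), N.Models T c d →
        N.Models p (Sum.elim (c ∘ f) (c ∘ c'')) (d ∘ d'')

/-- A theory with witnesses extending `Δ`. The formulas in it are obtained from formulas in `Δ` and
from formulas with fewer than `κ` variables by renaming the variables. -/
theorem exists_hasWitnesses {κ : Cardinal.{max u v t x w}} {C : Type (max u v t x w)}
    [CompactSpace X] [Nonempty X] [Nonempty C]
    (hL : Cardinal.lift.{max u v t x w} (L.card X) < κ)
    (h₀ : ℵ₀ ≤ κ) (hκ : κ ^< κ = κ) (hC : #C ≤ κ) (Δ : Set (L.FFormula X C X))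
    (hΔ : ∃ (M : StandardStructure.{u, v, t, x, max u v t x w} L X) (c : C → M),
      ∀ φ ∈ Δ, M.Realize φ c id) :
    ∃ T : Set (HenkinFormula L X C κ),
      Satisfiable.{u, v, t, x, max u v t x w} T ∧ HasWitnesses.{u, v, t, x, w} T ∧
      (∀ φ ∈ Δ, φ.relabel .inl .inl ∈ T) ∧
      ∀ ψ ∈ T, (∃ φ ∈ Δ, ψ = φ.relabel .inl .inl) ∨ ∃ (α : Type (max u v t x w))
        (φ : L.FFormula X (α ⊕ ℕ) (X ⊕ ℕ)) (g : α ⊕ ℕ → HenkinConst C κ)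
        (h : X ⊕ ℕ → X ⊕ κ.ord.ToType × ℕ), #α < κ ∧ ψ = φ.relabel g h := by
  have : Nonempty κ.ord.ToType := by
    rw [← Cardinal.mk_ne_zero_iff, Cardinal.mk_toType, Cardinal.card_ord]
    exact (Cardinal.aleph0_pos.trans_le h₀).ne'
  have : Nonempty (Request L X C κ) :=
    ⟨Classical.arbitrary _, fun _ => .inl (Classical.arbitrary C), ∅⟩
  obtain ⟨e, he⟩ := exists_enumeration h₀ (mk_request_le.{u, v, t, x, w} hL h₀ hκ hC)
  -- `Below` is part of the property: an accepted request then mentions only its own block and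
  -- earlier ones.
  obtain ⟨D, ⟨hDbelow, hDsat⟩, hD⟩ := exists_greedy
    (fun D => (∀ j ∈ D, (e j).Below j) ∧
      Satisfiable.{u, v, t, x, max u v t x w} (henkinTheory Δ e D))
    (fun D D' hDD' ⟨h, M, c, d, hM⟩ => ⟨fun j hj => h j (hDD' hj), M, c, d,
      hM.mono (henkinTheory_mono Δ e hDD')⟩)
    (fun D hD => ⟨fun j hj => (hD {j} (Set.singleton_subset_iff.2 hj)
        (Set.finite_singleton j)).1 j rfl, satisfiable_of_finite.{u, v, t, x, w} fun q hq hfin => by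
      obtain ⟨F, hFD, hF, hqF⟩ := exists_finite_subset_henkinTheory hq hfin
      obtain ⟨-, M, c, d, hM⟩ := hD F hFD hF
      exact ⟨M, c, d, hM.mono hqF⟩⟩)
    (by
      obtain ⟨M, c, hM⟩ := hΔ
      refine ⟨fun j hj => hj.elim, M, Sum.elim c fun _ => c (Classical.arbitrary C),
        fun _ => Classical.arbitrary X, ?_⟩
      rintro ψ (⟨φ, hφ, rfl⟩ | hψ)
      · exact (M.realize_relabel _ _ _ _ _).2 (hM φ hφ)
      · simp at hψ)
  refine ⟨henkinTheory Δ e D, hDsat, ?_, fun φ hφ => .inl ⟨φ, hφ, rfl⟩, ?_⟩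
  · intro α hα f p M c d hM c' d' hp
    obtain ⟨i, ⟨ε⟩⟩ := exists_equiv_Iio hα
    let r : Request L X C κ :=
      ⟨i, f ∘ ε, (fun φ => φ.relabel (Sum.map ε.symm id) id) '' p⟩
    -- Regularity places some stage after all new constants among the parameters; constants from `C`
    -- impose no bound and get an arbitrary index.
    obtain ⟨j₀, hj₀⟩ := exists_forall_lt_of_mk_lt h₀ hκ hα
      fun k => Sum.elim (fun _ => Classical.arbitrary κ.ord.ToType) Prod.fst (f k)
    obtain ⟨j, hj, hjr⟩ := he r j₀
    have hbelow : ∀ k s, f k = .inr s → s.1 < j := fun k s hs => by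
      have := hj₀ k
      rw [hs] at this
      exact this.trans_le hj
    have hjD : j ∈ D := by
      refine hD j ⟨?_, ?_⟩
      · rintro k (rfl | hk)
        · rw [hjr]
          exact fun k s hs => hbelow _ s hs
        · exact hDbelow k hk.1
      -- Reinterpret block `j` by the given realization. Request `j` becomes true, while Δ and the
      -- accepted requests before `j` do not mention this block. Later requests may fail, but
      -- acceptance at `j` does not involve them.
      · let c₁ : HenkinConst C κ → M := fun s =>
          Sum.elim (fun m => c (.inl m)) (fun s => if s.1 = j then c' s.2 else c (.inr s)) s
        let d₁ : κ.ord.ToType × ℕ → X := fun s => if s.1 = j then d' s.2 else d s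
        have hc₁ : ∀ s : HenkinConst C κ, (∀ s', s = .inr s' → s'.1 < j) →
            c₁ s = c s := by
          rintro (s | s) hs
          · rfl
          · exact if_neg (hs s rfl).ne
        refine ⟨M, c₁, d₁, ?_⟩
        rintro ψ (⟨φ, hφ, rfl⟩ | hψ)
        · have := hM _ (.inl ⟨φ, hφ, rfl⟩)
          rw [realize_relabel] at this ⊢
          exact this
        · obtain ⟨k, rfl | hk, hψk⟩ := Set.mem_iUnion₂.1 hψ
          · rw [hjr] at hψk
            obtain ⟨_, ⟨φ, hφ, rfl⟩, rfl⟩ := hψk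
            have := hp φ hφ
            rw [realize_relabel, realize_relabel]
            convert this using 1
            · funext s
              rcases s with s | s
              · simpa [r] using hc₁ (f s) (hbelow s)
              · simp [c₁]
            · funext s
              rcases s with s | s <;> simp [d₁]
          · obtain ⟨φ, hφ, rfl⟩ := hψk
            have := hM _ (.inr (Set.mem_iUnion₂.2 ⟨k, hk.1, φ, hφ, rfl⟩))
            rw [realize_relabel] at this ⊢
            convert this using 1
            · funext s
              rcases s with s | s
              · exact hc₁ _ fun s' hs' => (hDbelow k hk.1 s s' hs').trans hk.2
              · exact hc₁ _ fun s' hs' => Sum.inr.inj hs' ▸ hk.2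
            · funext s
              rcases s with s | s
              · rfl
              · exact if_neg hk.2.ne
    refine ⟨fun n => .inr (j, n), fun n => (j, n), fun N c d hN φ hφ => ?_⟩
    have := hN _ (.inr (Set.mem_iUnion₂.2 ⟨j, hjD, by
      rw [hjr]; exact ⟨_, ⟨φ, hφ, rfl⟩, rfl⟩⟩))
    rw [realize_relabel, realize_relabel] at this
    convert this using 1
    · funext s
      rcases s with s | s
      · simp [r]
      · rfl
    · funext s
      rcases s with s | s <;> rfl
  · rintro ψ (hψ | hψ)
    · obtain ⟨φ, hφ, rfl⟩ := hψ
      exact .inl ⟨φ, hφ, rfl⟩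
    · obtain ⟨j, hj, φ, hφ, rfl⟩ := Set.mem_iUnion₂.1 hψ
      exact .inr ⟨_, φ, _, _, mk_Iio_ord_lt _, rfl⟩

end Henkin

end StandardStructure

namespace StandardStructure

open HomeSpaceLanguage

/-! ### Descent to the substructure of constants. -/

section Restrict

variable {L : HomeSpaceLanguage.{u, v, t}} {X : Type x} [TopologicalSpace X]
  {α : Type a} {β : Type b}

/-- The standard structure on a substructure of the home structure. -/
def restrict (M : StandardStructure.{u, v, t, x, w} L X) (S : L.home.Substructure M) :
    StandardStructure.{u, v, t, x, w} L X where
  carrier := S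
  homeStructure := inferInstance
  mixedMap g m := M.mixedMap g fun i => (m i : M)

variable {M : StandardStructure.{u, v, t, x, w} L X} {S : L.home.Substructure M}

/-- The inclusion of a substructure. -/
def restrictVal (S : L.home.Substructure M) : M.restrict S → M :=
  Subtype.val

theorem termValue_restrict (s : L.SpaceTerm X α β) (c : α → M.restrict S) (d : β → X) :
    (M.restrict S).termValue c d s = M.termValue (restrictVal S ∘ c) d s := by
  induction s with
  | var j => rfl
  | spaceFun f ts ih => simp [termValue, ih]
  | mixedFun g ts =>
    refine congrArg (M.mixedMap g) (funext fun i => ?_)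
    exact (Language.HomClass.realize_term S.subtype (t := ts i) (v := c)).symm

/-- `F`-formulas are preserved by elementary substructures of the home structure containing
witnesses for existential quantifiers of the home sort. -/
theorem realizeBounded_restrict (hS : S.IsElementary)
    (hw : ∀ (k l : ℕ) (φ : L.FBoundedFormula X α β (k + 1) l) (c : α → M.restrict S) (d : β → X)
      (y : Fin k → M.restrict S) (z : Fin l → X) (m : M),
      M.RealizeBounded φ (restrictVal S ∘ c) d (Fin.snoc (restrictVal S ∘ y) m) z →
      ∃ m' : M.restrict S,
        M.RealizeBounded φ (restrictVal S ∘ c) d (Fin.snoc (restrictVal S ∘ y) (restrictVal S m')) z)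
    {k l : ℕ} (φ : L.FBoundedFormula X α β k l) (c : α → M.restrict S) (d : β → X)
    (y : Fin k → M.restrict S) (z : Fin l → X)
    (h : M.RealizeBounded φ (restrictVal S ∘ c) d (restrictVal S ∘ y) z) :
    (M.restrict S).RealizeBounded φ c d y z := by
  induction φ with
  | home φ =>
    exact ((⟨S, hS⟩ : L.home.ElementarySubstructure M).subtype.map_boundedFormula φ c y).1 h
  | mem ts C =>
    simp only [RealizeBounded, termValue_restrict, Sum.comp_elim]
    exact h
  | and φ ψ ihφ ihψ => exact ⟨ihφ y z h.1, ihψ y z h.2⟩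
  | or φ ψ ihφ ihψ => exact h.imp (ihφ y z) (ihψ y z)
  | allH φ ih =>
    refine fun m => ih (Fin.snoc y m) z ?_
    rw [Fin.comp_snoc]
    exact h (restrictVal S m)
  | exH φ ih =>
    obtain ⟨m, hm⟩ := h
    obtain ⟨m', hm'⟩ := hw _ _ φ c d y z m hm
    refine ⟨m', ih (Fin.snoc y m') z ?_⟩
    rwa [Fin.comp_snoc]
  | allS φ ih => exact fun s => ih y _ (h s)
  | exS φ ih => exact h.imp fun s => ih y _

end Restrict

section Henkin

variable {L : HomeSpaceLanguage.{u, v, t}} {X : Type x} [TopologicalSpace X]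
  {κ : Cardinal.{max u v t x w}} {C : Type (max u v t x w)}
  {T : Set (HenkinFormula L X C κ)} {M : StandardStructure.{u, v, t, x, max u v t x w} L X}
  {c : HenkinConst C κ → M} {d : κ.ord.ToType × ℕ → X}

/-- The witness property for a type consisting of one formula, read back in the same model. -/
theorem HasWitnesses.exists_realizeBounded [Nonempty X] (hT : HasWitnesses.{u, v, t, x, w} T)
    (h₀ : ℵ₀ ≤ κ) (hM : M.Models T c d) {α : Type (max u v t x w)} {β : Type b} (hα : #α < κ)
    {k l : ℕ} (φ : L.FBoundedFormula X α β (k + 1) l)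
    {a : α → M} (ha : ∀ i, a i ∈ Set.range c) (s : β → X) {y : Fin k → M}
    (hy : ∀ i, y i ∈ Set.range c) (z : Fin l → X) (m : M)
    (h : M.RealizeBounded φ a s (Fin.snoc y m) z) :
    ∃ m' ∈ Set.range c, M.RealizeBounded φ a s (Fin.snoc y m') z := by
  choose f hf using ha
  choose g hg using hy
  -- The last bound variable becomes variable 0 of the type; the other home variables become
  -- constants and the space values become parameters in $X$.
  let G : α ⊕ Fin (k + 1) → (α ⊕ ULift.{max u v t x w} (Fin k)) ⊕ ℕ :=
    Sum.elim (fun i => .inl (.inl i))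
      (Fin.snoc (α := fun _ => (α ⊕ ULift.{max u v t x w} (Fin k)) ⊕ ℕ)
        (fun i => .inl (.inr ⟨i⟩)) (.inr 0))
  let H : β ⊕ Fin l → X ⊕ ℕ := fun j => .inl (Sum.elim s z j)
  let F : α ⊕ ULift.{max u v t x w} (Fin k) → HenkinConst C κ := Sum.elim f fun i => g i.down
  have key : ∀ (c' : ℕ → M) (d' : ℕ → X),
      M.Realize (φ.free G H) (Sum.elim (c ∘ F) c') (Sum.elim id d') ↔
        M.RealizeBounded φ a s (Fin.snoc y (c' 0)) z := fun c' d' => by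
    rw [realize_free]
    have h₁ : Sum.elim (c ∘ F) c' ∘ G ∘ Sum.inl = a := funext hf
    have h₂ : Sum.elim (c ∘ F) c' ∘ G ∘ Sum.inr = Fin.snoc y (c' 0) := by
      funext i
      refine Fin.lastCases ?_ (fun i => ?_) i
      · simp [G]
      · simpa [G, F] using hg i
    rw [h₁, h₂]
    rfl
  have hα' : #(α ⊕ ULift.{max u v t x w} (Fin k)) < κ := by
    rw [Cardinal.mk_sum, Cardinal.lift_id, Cardinal.lift_id]
    exact Cardinal.add_lt_of_lt h₀ hα ((Cardinal.lt_aleph0_of_finite _).trans_le h₀)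
  obtain ⟨c'', d'', h''⟩ := hT _ hα' F {φ.free G H} M c d hM (fun _ => m)
    (fun _ => Classical.arbitrary X) (by
      rintro _ rfl
      exact (key _ _).2 h)
  exact ⟨c (c'' 0), ⟨_, rfl⟩, (key _ _).1 (h'' M c d hM _ rfl)⟩

/-- The substructure of the constants. -/
def HasWitnesses.substructure [Nonempty X] (hT : HasWitnesses.{u, v, t, x, w} T)
    (h₀ : ℵ₀ ≤ κ) (hM : M.Models T c d) : L.home.Substructure M where
  carrier := Set.range c
  fun_mem {n} f m hm := by
    -- The formula $f(y) = z$ has a witness among the constants, which must be the value of `f`.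
    obtain ⟨m', hm', h⟩ := hT.exists_realizeBounded h₀ hM (α := PEmpty) (β := PEmpty.{1})
      (by simpa using Cardinal.aleph0_pos.trans_le h₀)
      (.home (k := n + 1) (l := 0) (Language.Term.bdEqual
        (.func f fun i => .var (.inr (Fin.castSucc i))) (.var (.inr (Fin.last n)))))
      (a := PEmpty.elim) (fun i => i.elim) PEmpty.elim hm Fin.elim0 (Language.Structure.funMap f m)
      (by simp [RealizeBounded])
    have h : Language.Structure.funMap f m = m' := by simpa [RealizeBounded] using h
    exact h ▸ hm'

/-- The Tarski–Vaught test; home formulas, negations included, belong to `F`. -/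
theorem HasWitnesses.isElementary [Nonempty X] (hT : HasWitnesses.{u, v, t, x, w} T)
    (h₀ : ℵ₀ ≤ κ) (hM : M.Models T c d) : (hT.substructure h₀ hM).IsElementary := by
  refine Language.Substructure.isElementary_of_exists _ fun n φ y m h => ?_
  have key : ∀ m : M, M.RealizeBounded (.home (α := PEmpty.{(max u v t x w) + 1})
      (β := PEmpty.{1}) (l := 0)
      (relabelHome φ (α' := PEmpty.{(max u v t x w) + 1}) (Sum.map Empty.elim id)))
      PEmpty.elim PEmpty.elim (Fin.snoc (Subtype.val ∘ y) m) Fin.elim0 ↔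
      φ.Realize default (Fin.snoc (Subtype.val ∘ y) m : _ → M) := fun m => by
    refine realize_relabelHome φ _ (funext fun i => ?_)
    rcases i with i | i
    · exact i.elim
    · rfl
  obtain ⟨m', hm', h'⟩ := hT.exists_realizeBounded h₀ hM
    (by simpa using Cardinal.aleph0_pos.trans_le h₀) _ (fun i => i.elim) _
    (fun i => (y i).2) _ m ((key m).2 h)
  exact ⟨⟨m', hm'⟩, (key m').1 h'⟩

end Henkin

end StandardStructure

namespace StandardStructure

open HomeSpaceLanguage

/-! ### Saturation and the extension in a large universe. -/

section Saturated

variable {L : HomeSpaceLanguage.{u, v, t}} {X : Type x} [TopologicalSpace X]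
  {κ : Cardinal.{max u v t x w}} {C : Type (max u v t x w)}
  {T : Set (HenkinFormula L X C κ)}

theorem HasWitnesses.realize_restrict [Nonempty X] (hT : HasWitnesses.{u, v, t, x, w} T)
    (h₀ : ℵ₀ ≤ κ) {M : StandardStructure.{u, v, t, x, max u v t x w} L X}
    {c : HenkinConst C κ → M} {d : κ.ord.ToType × ℕ → X} (hM : M.Models T c d)
    {α : Type (max u v t x w)} {β : Type b} (hα : #α < κ) (φ : L.FFormula X α β)
    (a : α → M.restrict (hT.substructure h₀ hM)) (s : β → X)
    (h : M.Realize φ (restrictVal (hT.substructure h₀ hM) ∘ a) s) :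
    (M.restrict (hT.substructure h₀ hM)).Realize φ a s := by
  refine realizeBounded_restrict (hT.isElementary h₀ hM) (fun k l φ a s y z m hm => ?_) φ a s _ _ ?_
  · obtain ⟨m', hm', h⟩ := hT.exists_realizeBounded h₀ hM hα φ (fun i => (a i).2) s
      (fun i => (y i).2) z m hm
    exact ⟨⟨m', hm'⟩, h⟩
  · rwa [Realize, Subsingleton.elim Fin.elim0
      (restrictVal (hT.substructure h₀ hM) ∘ Fin.elim0)] at h

/-- A model of a theory with witnesses all of whose elements are constants is saturated. -/
theorem HasWitnesses.isFSaturatedAt [CompactSpace X] [Nonempty X]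
    (hT : HasWitnesses.{u, v, t, x, w} T)
    {N : StandardStructure.{u, v, t, x, max u v t x w} L X}
    {c : HenkinConst C κ → N} {d : κ.ord.ToType × ℕ → X} (hN : N.Models T c d)
    [Nonempty (HenkinConst C κ)]
    (hc : Function.Surjective c) : N.IsFSaturatedAt κ := by
  intro A hA n m p hp
  let f : A → HenkinConst C κ := fun s => Function.surjInv hc s
  have hf : ∀ s, c (f s) = s := fun s => Function.surjInv_eq hc s
  let ρ : HenkinFormula L X C κ → L.FFormula X (HenkinConst C κ ⊕ Fin n)
    (X ⊕ (κ.ord.ToType × ℕ) ⊕ Fin m) := fun φ => φ.relabel .inl (Sum.map id .inl)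
  let σ : L.FFormula X (A ⊕ Fin n) (Fin m) → L.FFormula X (HenkinConst C κ ⊕ Fin n)
    (X ⊕ (κ.ord.ToType × ℕ) ⊕ Fin m) := fun φ => φ.relabel (Sum.map f id) fun j => .inr (.inr j)
  -- `N` itself, with a realization of a finite part of `p`, satisfies each finite subset.
  have hsat : Satisfiable.{u, v, t, x, max u v t x w} (ρ '' T ∪ σ '' p) := by
    refine satisfiable_of_finite.{u, v, t, x, w} fun q hq hfin => ?_
    obtain ⟨q', hq'p, hq', hqq'⟩ := (Set.exists_subset_image_finite_and
      (p := fun r => q ∩ σ '' p ⊆ r)).1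
      ⟨q ∩ σ '' p, Set.inter_subset_right, hfin.inter_of_left _, subset_rfl⟩
    obtain ⟨c', d', h⟩ := hp q' hq'p hq'
    refine ⟨N, Sum.elim c c', Sum.elim d d', fun ψ hψ => ?_⟩
    obtain ⟨φ, hφ, rfl⟩ | hψ' := hq hψ
    · refine (N.realize_relabel _ _ _ _ _).2 ?_
      convert hN φ hφ using 1
      · rfl
      · funext j
        rcases j with j | j <;> rfl
    · obtain ⟨φ, hφ, rfl⟩ := hqq' ⟨hψ, hψ'⟩
      refine (N.realize_relabel _ _ _ _ _).2 ?_
      convert h φ hφ using 1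
      · funext j
        rcases j with j | j
        · exact hf j
        · rfl
      · rfl
  obtain ⟨M, c₁, d₁, hM⟩ := hsat
  have hMT : M.Models T (c₁ ∘ .inl) (d₁ ∘ .inl) := fun φ hφ => by
    have := (M.realize_relabel _ _ _ _ _).1 (hM _ (.inl ⟨φ, hφ, rfl⟩))
    convert this using 1
    funext j
    rcases j with j | j <;> rfl
  have hMne : Nonempty M := ⟨c₁ (.inl (Classical.arbitrary _))⟩
  let τ : L.FFormula X (A ⊕ Fin n) (Fin m) → L.FFormula X (A ⊕ ℕ) (X ⊕ ℕ) :=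
    fun φ => φ.relabel (Sum.map id Fin.val) fun j => .inr j
  -- Variables beyond the first `n` and `m` do not occur in `τ '' p`, so their values are arbitrary.
  obtain ⟨c'', d'', h⟩ := hT A hA f (τ '' p) M _ _ hMT
    (fun i => if hi : i < n then c₁ (.inr ⟨i, hi⟩) else Classical.arbitrary M)
    (fun j => if hj : j < m then d₁ (.inr ⟨j, hj⟩) else Classical.arbitrary X) (by
      rintro _ ⟨φ, hφ, rfl⟩
      refine (M.realize_relabel _ _ _ _ _).2 ?_
      convert (M.realize_relabel _ _ _ _ _).1 (hM _ (.inr ⟨φ, hφ, rfl⟩)) using 1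
      · funext i
        rcases i with i | i <;> simp
      · funext j
        simp)
  refine ⟨fun i => c (c'' i), fun j => d (d'' j), fun φ hφ => ?_⟩
  convert (N.realize_relabel _ _ _ _ _).1 (h N c d hN _ ⟨φ, hφ, rfl⟩) using 1
  · funext i
    rcases i with i | i
    · exact (hf i).symm
    · rfl
  · rfl

/-- Inequality of home elements is a home formula, hence in `F`. -/
theorem IsFElementaryEmbedding.injective {M : StandardStructure.{u, v, t, x, w} L X}
    {N : StandardStructure.{u, v, t, x, w'} L X} {e : M → N} (he : M.IsFElementaryEmbedding N e) :
    Function.Injective e := by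
  intro s s' h
  by_contra hne
  have := he 2 (.home (∼(Language.Term.bdEqual (.var (.inl 0)) (.var (.inl 1))))) ![s, s']
    (by simpa [Realize, RealizeBounded] using hne)
  exact absurd h (by simpa [Realize, RealizeBounded] using this)

/-- The `F`-formulas in fewer than `κ` home variables, which are true in `M`. -/
def diagram (M : StandardStructure.{u, v, t, x, w} L X) (κ : Cardinal.{w}) :
    Set (L.FFormula X M X) :=
  {ψ | ∃ (α : Type w) (φ : L.FFormula X α X) (g : α → M), #α < κ ∧ ψ = φ.relabel g id ∧
    M.Realize ψ id id}

/-- Existence of saturated extensions of size `κ` in a universe containing all symbols. -/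
theorem exists_isFSaturated [CompactSpace X] [Nonempty X]
    (hL : Cardinal.lift.{max u v t x w} (L.card X) < κ) (hκ : κ ^< κ = κ)
    (M : StandardStructure.{u, v, t, x, max u v t x w} L X) (hM : #M = κ) :
    ∃ (N : StandardStructure.{u, v, t, x, max u v t x w} L X) (e : M → N),
      M.IsFElementaryEmbedding N e ∧ N.IsFSaturatedAt κ ∧ #N = κ := by
  have h₁ : ℵ₀ < κ := by
    have := Cardinal.lift_le.{max u v t x w}.2 (L.aleph0_le_card X)
    rw [Cardinal.lift_aleph0] at this
    exact this.trans_lt hL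
  have h₀ : ℵ₀ ≤ κ := h₁.le
  have hMne : Nonempty M := by
    rw [← Cardinal.mk_ne_zero_iff, hM]
    exact (Cardinal.aleph0_pos.trans_le h₀).ne'
  obtain ⟨T, ⟨V, c, d, hV⟩, hT, hΔ, hsmall⟩ := exists_hasWitnesses.{u, v, t, x, w} hL h₀ hκ hM.le
    (M.diagram κ) ⟨M, id, fun ψ hψ => by obtain ⟨_, _, _, _, _, h⟩ := hψ; exact h⟩
  let S := hT.substructure h₀ hV
  let N := V.restrict S
  let c' : HenkinConst M κ → N := fun s => ⟨c s, s, rfl⟩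
  -- Descent requires fewer than κ home variables, although `T` is written with possibly κ
  -- constants; each formula is therefore traced back to the small set of variables it was renamed
  -- from.
  have hNT : N.Models T c' d := by
    intro ψ hψ
    have hVψ := hV ψ hψ
    obtain ⟨_, ⟨α, φ, g, hα, rfl, -⟩, rfl⟩ | ⟨α, φ, g, h, hα, rfl⟩ := hsmall ψ hψ
    · rw [realize_relabel, realize_relabel] at hVψ ⊢
      exact hT.realize_restrict h₀ hV hα φ _ _ hVψ
    · rw [realize_relabel] at hVψ ⊢
      refine hT.realize_restrict h₀ hV ?_ φ _ _ hVψ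
      rw [Cardinal.mk_sum, Cardinal.mk_nat, Cardinal.lift_aleph0, Cardinal.lift_uzero]
      exact Cardinal.add_lt_of_lt h₀ hα h₁
  have hc' : Function.Surjective c' := by
    rintro ⟨_, s, hs⟩
    exact ⟨s, Subtype.ext hs⟩
  have he : M.IsFElementaryEmbedding N fun m => c' (.inl m) := by
    intro n φ a h
    let ψ : L.FFormula X (ULift.{max u v t x w} (Fin n)) X := φ.relabel ULift.up Empty.elim
    have hψ : ψ.relabel (a ∘ ULift.down) id ∈ M.diagram κ := by
      refine ⟨_, ψ, _, (Cardinal.lt_aleph0_of_finite _).trans_le h₀, rfl, ?_⟩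
      rw [realize_relabel, realize_relabel]
      convert h using 1
      rfl
    have := hNT _ (hΔ _ hψ)
    rw [realize_relabel, realize_relabel, realize_relabel] at this
    convert this using 1
    rfl
  refine ⟨N, _, he, hT.isFSaturatedAt hNT hc', le_antisymm ?_ ?_⟩
  · exact (Cardinal.mk_le_of_surjective hc').trans (mk_henkinConst_le h₀ hM.le)
  · exact hM.ge.trans (Cardinal.mk_le_of_injective he.injective)

end Saturated

end StandardStructure

namespace StandardStructure

open HomeSpaceLanguage

/-! ### Transport along bijections and change of universe. -/

section Transport

variable {L : HomeSpaceLanguage.{u, v, t}} {X : Type x} [TopologicalSpace X]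
  {α : Type a} {β : Type b} {M : StandardStructure.{u, v, t, x, w} L X} {N : Type w'}

/-- Transport a standard structure along a bijection. -/
def ofEquiv (M : StandardStructure.{u, v, t, x, w} L X) (e : M ≃ N) :
    StandardStructure.{u, v, t, x, w'} L X where
  carrier := N
  homeStructure := e.inducedStructure
  mixedMap g m := M.mixedMap g (e.symm ∘ m)

/-- The bijection onto the transported structure. -/
def toOfEquiv (e : M ≃ N) : M ≃ M.ofEquiv e :=
  e

theorem termValue_ofEquiv (e : M ≃ N) (s : L.SpaceTerm X α β) (c : α → M) (d : β → X) :
    (M.ofEquiv e).termValue (toOfEquiv e ∘ c) d s = M.termValue c d s := by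
  induction s with
  | var j => rfl
  | spaceFun f ts ih => simp [termValue, ih]
  | mixedFun g ts =>
    refine congrArg (M.mixedMap g) (funext fun i => ?_)
    let _ : L.home.Structure N := e.inducedStructure
    exact e.symm_apply_eq.2 (Language.HomClass.realize_term
      (e.inducedStructureEquiv : M ≃[L.home] N) (t := ts i) (v := c))

theorem realizeBounded_ofEquiv (e : M ≃ N) {k l : ℕ} (φ : L.FBoundedFormula X α β k l)
    (c : α → M) (d : β → X) (y : Fin k → M) (z : Fin l → X) :
    (M.ofEquiv e).RealizeBounded φ (toOfEquiv e ∘ c) d (toOfEquiv e ∘ y) z ↔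
      M.RealizeBounded φ c d y z := by
  induction φ with
  | home φ =>
    let _ : L.home.Structure N := e.inducedStructure
    exact Language.StrongHomClass.realize_boundedFormula
      (e.inducedStructureEquiv : M ≃[L.home] N) φ (v := c) (xs := y)
  | mem ts C =>
    simp only [RealizeBounded, ← Sum.comp_elim, termValue_ofEquiv]
  | and φ ψ ihφ ihψ => exact and_congr (ihφ y z) (ihψ y z)
  | or φ ψ ihφ ihψ => exact or_congr (ihφ y z) (ihψ y z)
  | allH φ ih =>
    refine ((toOfEquiv e).forall_congr fun m => ?_).symm
    rw [← Fin.comp_snoc]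
    exact (ih _ z).symm
  | exH φ ih =>
    refine ((toOfEquiv e).exists_congr fun m => ?_).symm
    rw [← Fin.comp_snoc]
    exact (ih _ z).symm
  | allS φ ih => exact forall_congr' fun s => ih y _
  | exS φ ih => exact exists_congr fun s => ih y _

theorem realize_ofEquiv (e : M ≃ N) (φ : L.FFormula X α β) (c : α → M) (d : β → X) :
    (M.ofEquiv e).Realize φ (toOfEquiv e ∘ c) d ↔ M.Realize φ c d := by
  rw [Realize, Subsingleton.elim Fin.elim0 (toOfEquiv e ∘ Fin.elim0)]
  exact realizeBounded_ofEquiv e φ c d _ _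

theorem IsFSaturatedAt.ofEquiv {κ : Cardinal.{w}} {κ' : Cardinal.{w'}}
    (h : M.IsFSaturatedAt κ) (e : M ≃ N) (hκ : Cardinal.lift.{w} κ' = Cardinal.lift.{w'} κ) :
    (M.ofEquiv e).IsFSaturatedAt κ' := by
  intro A hA n m p hp
  let B : Set M := toOfEquiv e ⁻¹' A
  let ε : B ≃ A := (toOfEquiv e).subtypeEquiv fun _ => Iff.rfl
  have hB : #B < κ := by
    rw [← Cardinal.lift_lt.{w, w'}, ← hκ, Cardinal.lift_mk_eq'.2 ⟨ε⟩]
    exact Cardinal.lift_lt.2 hA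
  let ρ : L.FFormula X (A ⊕ Fin n) (Fin m) → L.FFormula X (B ⊕ Fin n) (Fin m) :=
    fun φ => φ.relabel (Sum.map ε.symm id) id
  have key : ∀ (φ : L.FFormula X (A ⊕ Fin n) (Fin m)) (c : Fin n → M) (d : Fin m → X),
      M.Realize (ρ φ) (Sum.elim (fun s : B => (s : M)) c) d ↔
      (M.ofEquiv e).Realize φ (Sum.elim (fun s : A => (s : M.ofEquiv e)) (toOfEquiv e ∘ c)) d := by
    intro φ c d
    rw [realize_relabel, ← realize_ofEquiv e]
    have : toOfEquiv e ∘ Sum.elim (fun s : B => (s : M)) c ∘ Sum.map ε.symm id =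
        Sum.elim (fun s : A => (s : M.ofEquiv e)) (toOfEquiv e ∘ c) := by
      funext i
      rcases i with i | i
      · exact (toOfEquiv e).apply_symm_apply _
      · rfl
    rw [this]
    rfl
  obtain ⟨c, d, hcd⟩ := h B hB n m (ρ '' p) fun q hq hfin => by
    obtain ⟨q', hq'p, hq', rfl⟩ := (Set.exists_subset_image_finite_and
      (p := fun r => q = r)).1 ⟨q, hq, hfin, rfl⟩
    obtain ⟨c, d, h⟩ := hp q' hq'p hq'
    refine ⟨(toOfEquiv e).symm ∘ c, d, ?_⟩
    rintro _ ⟨φ, hφ, rfl⟩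
    refine (key _ _ _).2 ?_
    rw [← Function.comp_assoc, Equiv.self_comp_symm]
    exact h φ hφ
  exact ⟨toOfEquiv e ∘ c, d, fun φ hφ => (key _ _ _).1 (hcd _ ⟨φ, hφ, rfl⟩)⟩

end Transport

end StandardStructure

/-- Every cardinal below a lift is itself a lift, so the powers are computed in the smaller
universe. -/
theorem lift_powerlt_self {κ : Cardinal.{w}} (h₁ : 1 < κ) (hκ : κ ^< κ = κ) :
    Cardinal.lift.{a} κ ^< Cardinal.lift.{a} κ = Cardinal.lift.{a} κ := by
  refine le_antisymm (Cardinal.powerlt_le.2 fun c hc => ?_) ?_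
  · obtain ⟨c, rfl⟩ := Cardinal.mem_range_lift_of_le hc.le
    rw [← Cardinal.lift_power, Cardinal.lift_le]
    exact (Cardinal.le_powerlt κ (Cardinal.lift_lt.1 hc)).trans_eq hκ
  · simpa using Cardinal.le_powerlt (Cardinal.lift.{a} κ) (c := 1) (by simpa using h₁)

theorem mainTheorem2 {X : Type x} [TopologicalSpace X] [CompactSpace X] [T2Space X] [Nonempty X]
    (L : HomeSpaceLanguage.{u, v, t}) (κ : Cardinal.{w}) (hκ : κ ^< κ = κ)
    (hL : Cardinal.lift.{w} (L.card X) < Cardinal.lift.{max u v t x} κ)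
    (M : StandardStructure.{u, v, t, x, w} L X) (hM : #M = κ) :
    ∃ (N : StandardStructure.{u, v, t, x, w} L X) (e : M → N),
      M.IsFElementaryEmbedding N e ∧ N.IsFSaturated ∧ #N = κ := by
  have h₁ : 1 < κ := by
    have h : (1 : Cardinal.{max u v t x w}) < Cardinal.lift.{max u v t x} κ := by
      refine lt_of_le_of_lt ?_ hL
      simpa using Cardinal.lift_le.{w}.2 (Cardinal.one_le_aleph0.trans (L.aleph0_le_card X))
    simpa using h
  -- The construction runs in a universe containing all symbols; since `N` has the lifted
  -- cardinality of `M`, it can be carried back to the carrier of `M`.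
  let up : M ≃ ULift.{max u v t x} M := Equiv.ulift.symm
  obtain ⟨N, e, he, hN, hNκ⟩ := StandardStructure.exists_isFSaturated.{u, v, t, x, w}
    (κ := Cardinal.lift.{max u v t x} κ) (by rwa [Cardinal.lift_umax.{max u v t x, w}])
    (lift_powerlt_self h₁ hκ) (M.ofEquiv up) (by rw [← hM]; rfl)
  have hNM : Nonempty (N ≃ M) := by
    rw [← Cardinal.lift_mk_eq', hNκ, hM, Cardinal.lift_lift]
  obtain ⟨ε⟩ := hNM
  have hsat : (N.ofEquiv ε).IsFSaturatedAt κ := hN.ofEquiv ε (by rw [Cardinal.lift_lift])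
  refine ⟨N.ofEquiv ε, StandardStructure.toOfEquiv ε ∘ e ∘ StandardStructure.toOfEquiv up,
    fun n φ c h => ?_, ?_, hM⟩
  · exact (StandardStructure.realize_ofEquiv ε φ _ _).2
      (he n φ _ ((StandardStructure.realize_ofEquiv up φ c _).2 h))
  · have hcard : #(N.ofEquiv ε) = κ := hM
    rwa [StandardStructure.IsFSaturated, hcard]
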